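/- **Setting.** Let $U_2$ be a finite-dimensional unitary matrix with real entries whose $1$-eigenspace is one-dimensional, spanned by the real unit vector $|\phi_0\rangle$; let $|\mu\rangle$ be a real unit vector, $U_1=I-2|\mu\rangle\langle\mu|$, $U=U_2U_1$, and $|\tilde\phi_0\rangle=|\phi_0\rangle-\langle\phi_0|\mu\rangle|\mu\rangle$. Let $e^{\pm i\alpha_j}$, $0<\alpha_j<\pi$, be the distinct non-real eigenvalues of $U$, and write $$|\tilde\phi_0\rangle=\delta_0|w_0\rangle+\sum_j\delta_j\bigl(|w_j^+\rangle+|w_j^-\rangle\bigr)+\delta_{-1}|w_{-1}\rangle$$ with $\delta$'s real and $|w_0\rangle,|w_j^{\pm}\rangle,|w_{-1}\rangle$ unit eigenvectors of $U$ for the eigenvalues $1$, $e^{\pm i\alpha_j}$, $-1$, where $|w_j^-\rangle=\overline{|w_j^+\rangle}$. The $U$-rotation of $|\tilde\phi_0\rangle$ is $\delta_0|w_0\rangle+\sum_j\delta_j(|w_j^+\rangle-|w_j^-\rangle)+\delta_{-1}|w_{-1}\rangle$. Let $QH$ take the value $1/\alpha_j$ with probability $2\delta_j^2$, the value $1/\pi$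 with probability $\delta_{-1}^2$, and the value $0$ otherwise, and for $0<\varepsilon<1$ let $$\mathsf{QHT}_\varepsilon(U_2,|\mu\rangle)=\min\{y\ge 0:\Pr[QH>y]\le\varepsilon\}.$$ **Procedure.** For constants $a,b>0$, $\mathrm{Rotate}(U,\Delta,\varepsilon)$ is the following circuit, which accesses $U$ only through applications of controlled-$U$ and its inverse. It uses $k=\lfloor a\log(1/\varepsilon)\rfloor$ ancilla registers of $m$ qubits each, all initialised to $0$, where $m\geq 0$ is the least integer with $2^m\ge b/\Delta$. 1. On each register perform phase estimation of $U$ on the same input state: Hadamard gates on all $m$ qubits, then for each $i<m$ the operator $U^{2^i}$ controlled by qubit $i$, carried out as $2^i$ applications of controlled-$U$, then the inverse quantum Fourier transform modulo $2^m$. The content $y\in\{0,\dots,2^m-1\}$ of a register stands for the estimated phase in $(-\pi,\pi]$ congruent to $2\pi y/2^m$ modulo $2\pi$. 2. Multiply by $-1$ the ancilla basis states in which more than $k/2$ of the estimated phases are negative. 3. Undo step 1. **Theorem.** There are absolute constants $a_0,b_0>0$ such that for all $a\ge a_0$ and $b\ge b_0$ there is $C>0$, depending only on $a,b$, with the following property.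 Let $U_2,|\phi_0\rangle,|\mu\rangle$ be as above, in any finite dimension, assume that every eigenvalue $e^{i\alpha}$ of $U$, $\alpha\in(-\pi,\pi]$, satisfies $|\alpha|\le\pi/2$, and let $0<\varepsilon<1$ and $T>0$ with $T\ge\mathsf{QHT}_\varepsilon(U_2,|\mu\rangle)$. Then $\mathrm{Rotate}(U,1/T,\varepsilon)$ maps $|\tilde\phi_0\rangle|0\cdots0\rangle$ to a vector within Euclidean distance $C\sqrt\varepsilon$ of $|\psi\rangle|0\cdots0\rangle$, where $|\psi\rangle$ is the $U$-rotation of $|\tilde\phi_0\rangle$, and it uses at most $C\log(1/\varepsilon)\,T$ applications of controlled-$U$ and its inverse in total. In particular, for $T=\mathsf{QHT}_\varepsilon(U_2,|\mu\rangle)>0$ this number is $O(\log(1/\varepsilon)\cdot\mathsf{QHT}_\varepsilon(U_2,|\mu\rangle))$. -/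

import Mathlib

open MeasureTheory
open scoped Matrix Kronecker

namespace QuantumSearch

noncomputable section

universe u

/-! ### Spectral notions for a matrix `U` acting on `ℂ^ι` -/

section Spectral

variable {ι : Type u} [Fintype ι] [DecidableEq ι]

/-- The `z`-eigenspace of `U` (the zero subspace if `z` is not an eigenvalue). -/
def eigenspace (U : Matrix ι ι ℂ) (z : ℂ) : Submodule ℂ (EuclideanSpace ℂ ι) :=
  Module.End.eigenspace (Matrix.toEuclideanLin U) z

/-- The component of `ψ` in the `z`-eigenspace of `U`: the orthogonal projection of `ψ`. -/
def eigencomponent (U : Matrix ι ι ℂ) (z : ℂ) (ψ : EuclideanSpace ℂ ι) : EuclideanSpace ℂ ι :=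
  (eigenspace U z).starProjection ψ

/-- The eigenvalues `z_j = e^{i α_j}` of `U` in the open upper half plane.
For unitary `U` their phases are the `α_j = arg z_j ∈ (0, π)`. -/
def upperEigenvalues (U : Matrix ι ι ℂ) : Finset ℂ :=
  (Module.End.finite_hasEigenvalue (Matrix.toEuclideanLin U)).toFinset.filter (fun z => 0 < z.im)

/-- All eigenphases `α ∈ (-π, π]` of `U` satisfy `|α| ≤ π / 2`. -/
def PhasesAtMostHalfPi (U : Matrix ι ι ℂ) : Prop :=
  ∀ z : ℂ, Module.End.HasEigenvalue (Matrix.toEuclideanLin U) z → |z.arg| ≤ Real.pi / 2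

/-- The `U`-rotation of `ψ`. With
`ψ = δ_0 w_0 + ∑_j δ_j (w_j^+ + w_j^-) + δ_{-1} w_{-1}`, where `w_0`, `w_j^±`, `w_{-1}` are unit
eigenvectors for `1`, `e^{± i α_j}`, `-1`, this is
`δ_0 w_0 + ∑_j δ_j (w_j^+ - w_j^-) + δ_{-1} w_{-1}`.
Here `δ_j w_j^±` is the component of `ψ` in the eigenspace of `e^{± i α_j}`. -/
def rotation (U : Matrix ι ι ℂ) (ψ : EuclideanSpace ℂ ι) : EuclideanSpace ℂ ι :=
  eigencomponent U 1 ψ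
    + ∑ z ∈ upperEigenvalues U,
        (eigencomponent U z ψ - eigencomponent U ((starRingEnd ℂ) z) ψ)
    + eigencomponent U (-1) ψ

/-- The law of the random variable `QH` of `U` and (real) `ψ`: value `1 / α_j` with probability
`2 δ_j²`, value `1 / π` with probability `δ_{-1}²`, and value `0` otherwise. Since `ψ` need not be
normalized, the total mass is `‖ψ‖²`; here `δ_j² = ‖δ_j w_j^+‖²`. -/
def lawQH (U : Matrix ι ι ℂ) (ψ : EuclideanSpace ℂ ι) : Measure ℝ :=
  (∑ z ∈ upperEigenvalues U,
      ENNReal.ofReal (2 * ‖eigencomponent U z ψ‖ ^ 2) • Measure.dirac (1 / z.arg))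
    + ENNReal.ofReal (‖eigencomponent U (-1) ψ‖ ^ 2) • Measure.dirac (1 / Real.pi)
    + ENNReal.ofReal (‖eigencomponent U 1 ψ‖ ^ 2) • Measure.dirac 0

end Spectral

/-! ### Abstract search algorithms and the quantum hitting time -/

/-- An abstract search algorithm: a real unitary matrix `U₂` whose `1`-eigenspace is the line
spanned by the real unit vector `φ₀`, and a real unit target vector `μ`. -/
structure AbstractSearch (ι : Type u) [Fintype ι] [DecidableEq ι] where
  U₂ : Matrix ι ι ℝ
  U₂_mem : U₂ ∈ Matrix.orthogonalGroup ι ℝ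
  φ₀ : EuclideanSpace ℝ ι
  norm_φ₀ : ‖φ₀‖ = 1
  fixed : Matrix.toEuclideanLin U₂ φ₀ = φ₀
  unique : ∀ v : EuclideanSpace ℝ ι, Matrix.toEuclideanLin U₂ v = v → ∃ c : ℝ, v = c • φ₀
  μ : EuclideanSpace ℝ ι
  norm_μ : ‖μ‖ = 1

namespace AbstractSearch

variable {ι : Type u} [Fintype ι] [DecidableEq ι]

/-- `U₁ = I - 2 |μ⟩⟨μ|`. -/
def U₁ (S : AbstractSearch ι) : Matrix ι ι ℝ :=
  1 - (2 : ℝ) • Matrix.vecMulVec (fun i => S.μ i) (fun i => S.μ i)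

/-- `U = U₂ U₁`, as a complex matrix. -/
def U (S : AbstractSearch ι) : Matrix ι ι ℂ :=
  (S.U₂ * S.U₁).map (fun x : ℝ => (x : ℂ))

/-- The starting vector `φ̃₀ = φ₀ - ⟨φ₀, μ⟩ μ`, as a complex vector. -/
def start (S : AbstractSearch ι) : EuclideanSpace ℂ ι :=
  WithLp.toLp 2 (fun i => (((S.φ₀ - (inner ℝ S.φ₀ S.μ) • S.μ) i : ℝ) : ℂ))

/-- The quantum `ε`-error hitting time
`QHT_ε(U₂, μ) = min {y ≥ 0 : Pr[QH > y] ≤ ε}`, for the starting vector `φ̃₀`. -/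
def hittingTime (S : AbstractSearch ι) (ε : ℝ) : ℝ :=
  sInf {y : ℝ | 0 ≤ y ∧ lawQH S.U S.start (Set.Ioi y) ≤ ENNReal.ofReal ε}

/-- The infimum in the definition of the hitting time is a minimum. -/
theorem hittingTime_isLeast (S : AbstractSearch ι) {ε : ℝ} (hε : 0 < ε) :
    IsLeast {y : ℝ | 0 ≤ y ∧ lawQH S.U S.start (Set.Ioi y) ≤ ENNReal.ofReal ε}
      (S.hittingTime ε) := by
  have hfin : IsFiniteMeasure (lawQH S.U S.start) := by
    refine ⟨?_⟩
    simp only [lawQH, one_div, Measure.coe_add, Measure.coe_finset_sum, Pi.add_apply,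
      Finset.sum_apply, Measure.smul_apply, smul_eq_mul, measure_univ, mul_one]
    refine ENNReal.add_lt_top.mpr ⟨ENNReal.add_lt_top.mpr ⟨?_, ENNReal.ofReal_lt_top⟩,
      ENNReal.ofReal_lt_top⟩
    exact ENNReal.sum_lt_top.mpr fun z _ => ENNReal.ofReal_lt_top
  set A : Set ℝ := {y : ℝ | 0 ≤ y ∧ lawQH S.U S.start (Set.Ioi y) ≤ ENNReal.ofReal ε} with hA
  have hbdd : BddBelow A := ⟨0, fun y hy => hy.1⟩
  have hne : A.Nonempty := by
    have h := tendsto_measure_iInter_atTop (μ := lawQH S.U S.start)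
      (s := fun n : ℕ => Set.Ioi (n : ℝ)) (fun n => measurableSet_Ioi.nullMeasurableSet)
      (fun i j hij => Set.Ioi_subset_Ioi (by exact_mod_cast hij)) ⟨0, measure_ne_top _ _⟩
    have h0 : (⋂ n : ℕ, Set.Ioi (n : ℝ)) = ∅ := by
      ext x
      obtain ⟨n, hn⟩ := exists_nat_ge x
      simp only [Set.mem_iInter, Set.mem_Ioi, Set.mem_empty_iff_false, iff_false, not_forall,
        not_lt]
      exact ⟨n, hn⟩
    rw [h0, measure_empty] at h
    obtain ⟨n, hn⟩ := (h.eventually_lt_const (ENNReal.ofReal_pos.mpr hε)).exists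
    exact ⟨n, Nat.cast_nonneg n, hn.le⟩
  refine ⟨⟨le_csInf hne fun y hy => hy.1, ?_⟩, fun y hy => csInf_le hbdd hy⟩
  obtain ⟨u, hu, -, hlim, hmem⟩ := (isGLB_csInf hne hbdd).exists_seq_antitone_tendsto hne
  have hU : Set.Ioi (sInf A) = ⋃ n, Set.Ioi (u n) := by
    ext x
    simp only [Set.mem_Ioi, Set.mem_iUnion]
    refine ⟨fun hx => (hlim.eventually_lt_const hx).exists, ?_⟩
    rintro ⟨n, hn⟩
    exact (csInf_le hbdd (hmem n)).trans_lt hn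
  change lawQH S.U S.start (Set.Ioi (sInf A)) ≤ _
  have hmono : Monotone (fun n => Set.Ioi (u n)) := fun i j hij => Set.Ioi_subset_Ioi (hu hij)
  rw [hU, hmono.measure_iUnion]
  exact iSup_le fun n => (hmem n).2

end AbstractSearch

/-! ### Circuits with controlled applications of `U`

The workspace consists of `k` registers of `m` qubits each; circuits act on `ℂ^ι ⊗ ℂ^(Work k m)`. -/

/-- Computational basis states of a register of `m` qubits. -/
abbrev Reg (m : ℕ) : Type := Fin m → Bool

/-- Computational basis states of `k` registers of `m` qubits. -/
abbrev Work (k m : ℕ) : Type := Fin k → Reg m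

/-- The elementary steps: an operator `W` on the workspace alone, or one application of `U`,
respectively of its inverse, controlled by the `i`-th qubit of register `r`. -/
inductive Gate (k m : ℕ) : Type
  | work (W : Matrix (Work k m) (Work k m) ℂ) : Gate k m
  | ctrl (r : Fin k) (i : Fin m) : Gate k m
  | ctrlInv (r : Fin k) (i : Fin m) : Gate k m

namespace Gate

variable {ι : Type u} [Fintype ι] [DecidableEq ι] {k m : ℕ}

/-- The operator performed by a gate (`Uᴴ` is the inverse of the unitary `U`). -/
def mat (U : Matrix ι ι ℂ) : Gate k m → Matrix (ι × Work k m) (ι × Work k m) ℂ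
  | work W => (1 : Matrix ι ι ℂ) ⊗ₖ W
  | ctrl r i => Matrix.blockDiagonal (fun x : Work k m => if x r i = true then U else 1)
  | ctrlInv r i => Matrix.blockDiagonal (fun x : Work k m => if x r i = true then Uᴴ else 1)

/-- The number of applications of controlled-`U` or its inverse in a gate. -/
def calls : Gate k m → ℕ
  | work _ => 0
  | ctrl _ _ => 1
  | ctrlInv _ _ => 1

/-- The adjoint gate. -/
def adjoint : Gate k m → Gate k m
  | work W => work Wᴴ
  | ctrl r i => ctrlInv r i
  | ctrlInv r i => ctrl r i

end Gate

/-- A circuit: a list of gates, the head being performed first. -/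
abbrev Circuit (k m : ℕ) : Type := List (Gate k m)

namespace Circuit

variable {ι : Type u} [Fintype ι] [DecidableEq ι] {k m : ℕ}

/-- The operator performed by a circuit. -/
def mat (U : Matrix ι ι ℂ) : Circuit k m → Matrix (ι × Work k m) (ι × Work k m) ℂ
  | [] => 1
  | g :: c => mat U c * g.mat U

/-- The number of applications of controlled-`U` and its inverse in a circuit. -/
def calls (c : Circuit k m) : ℕ := (c.map Gate.calls).sum

/-- The circuit undoing `c` (for a circuit of unitary gates). -/
def undo (c : Circuit k m) : Circuit k m := (c.map Gate.adjoint).reverse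

/-- The state to which the circuit, for the operator `U`, takes a state. -/
def run (U : Matrix ι ι ℂ) (c : Circuit k m) (Ψ : EuclideanSpace ℂ (ι × Work k m)) :
    EuclideanSpace ℂ (ι × Work k m) :=
  Matrix.toEuclideanLin (mat U c) Ψ

end Circuit

/-- The state `ψ ⊗ |0…0⟩`. -/
def withZeros {ι : Type u} [Fintype ι] (k m : ℕ) (ψ : EuclideanSpace ℂ ι) :
    EuclideanSpace ℂ (ι × Work k m) :=
  WithLp.toLp 2 (fun p => if p.2 = (fun _ _ => false) then ψ p.1 else 0)

/-! ### Phase estimation -/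

/-- The integer in `{0, …, 2^m - 1}` written in a register. -/
def regValue {m : ℕ} (x : Reg m) : ℕ := ∑ i : Fin m, if x i = true then 2 ^ (i : ℕ) else 0

/-- A Hadamard gate on each of `m` qubits. -/
def hadamard (m : ℕ) : Matrix (Reg m) (Reg m) ℂ :=
  fun y x => ∏ i : Fin m, (if y i = true ∧ x i = true then (-1 : ℂ) else 1) / (Real.sqrt 2 : ℂ)

/-- The inverse quantum Fourier transform modulo `2^m`. -/
def invQFT (m : ℕ) : Matrix (Reg m) (Reg m) ℂ :=
  fun y x => Complex.exp (-(2 * Real.pi * Complex.I * (regValue x : ℂ) * (regValue y : ℂ) / 2 ^ m))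
    / (Real.sqrt (2 ^ m) : ℂ)

/-- The operator `V` applied to register `r`, the identity on the others. -/
def onRegister {k m : ℕ} (r : Fin k) (V : Matrix (Reg m) (Reg m) ℂ) :
    Matrix (Work k m) (Work k m) ℂ :=
  fun y x => if ∀ s, s ≠ r → y s = x s then V (y r) (x r) else 0

/-- The phase estimation circuit on register `r`: Hadamard gates, then for each `i < m` the
operator `U^(2^i)` controlled by qubit `i` (as `2^i` applications of controlled-`U`), then the
inverse Fourier transform. -/
def estimate {k m : ℕ} (r : Fin k) : Circuit k m :=
  [Gate.work (onRegister r (hadamard m))]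
    ++ (List.finRange m).flatMap (fun i : Fin m =>
        List.replicate (2 ^ (i : ℕ)) (Gate.ctrl r i))
    ++ [Gate.work (onRegister r (invQFT m))]

/-- The phase in `(-π, π]` that a register content stands for:
`2 π y / 2^m` modulo `2 π`, where `y` is the value of the register. -/
def estimatedPhase {m : ℕ} (x : Reg m) : ℝ :=
  if 2 * regValue x ≤ 2 ^ m then 2 * Real.pi * regValue x / 2 ^ m
  else 2 * Real.pi * regValue x / 2 ^ m - 2 * Real.pi

/-- The phase flip on the basis states in which more than half of the `k` estimated phases are
negative. -/
def majorityFlip (k m : ℕ) : Matrix (Work k m) (Work k m) ℂ :=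
  Matrix.diagonal (fun x =>
    if k < 2 * (Finset.univ.filter (fun r : Fin k => estimatedPhase (x r) < 0)).card
    then -1 else 1)

/-- `k` phase estimations with `m` qubits each on the same state, the phase flip if the majority of
the estimated phases are negative, and the undoing of the phase estimations. -/
def rotateCircuit (k m : ℕ) : Circuit k m :=
  let estimates : Circuit k m := (List.finRange k).flatMap estimate
  estimates ++ [Gate.work (majorityFlip k m)] ++ Circuit.undo estimates

/-- The number of repetitions of phase estimation, `Θ(log (1 / ε))` with constant `a`. -/
def repetitions (a ε : ℝ) : ℕ := ⌊a * Real.log (1 / ε)⌋₊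

/-- The number of qubits of phase estimation with precision `Δ`: the least `m` with
`b / Δ ≤ 2^m`, where `b` is a constant, so that the spacing `2 π / 2^m` of the estimates is at most
`2 π Δ / b`. -/
def qubits (b Δ : ℝ) : ℕ := Nat.clog 2 ⌈b / Δ⌉₊

/-- The procedure `Rotate(U, Δ, ε)`, with constants `a` for the number of repetitions and `b` for
the precision. It accesses `U` only through controlled applications. -/
def Rotate (a b Δ ε : ℝ) : Circuit (repetitions a ε) (qubits b Δ) :=
  rotateCircuit (repetitions a ε) (qubits b Δ)

end

end QuantumSearch

/-!
On `v ⊗ w`, where `v` is an eigenvector of `U` for `z = e^{iα}`, every circuit acts as `v ⊗ W w` for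
a matrix `W` on the workspace depending only on `z`: controlled-`U` becomes a controlled scalar. As
eigenvectors for distinct eigenvalues of a normal matrix are orthogonal, the squared error of
`Rotate` on `ψ` is the average, with weights `‖ψ_z‖²`, of its squared errors on the eigenvalues `z`.

For a single eigenvalue the `k` registers are independent and the phase flip is conjugated by the
unitary phase estimation. Hence the squared error is four times the probability that the majority
of the registers has the wrong sign. A register has it with probability at most `1/16` if `2^m |α|`
is large, by the decay of the Dirichlet kernel, and with probability `0` if `α = 0`; a majority of
wrong signs then has probability at most `2^{-k}`, which is at most `2ε`. The remaining eigenvalues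
have `1/|α| > T`, carry total weight at most `ε` by the choice of the hitting time, and contribute
at most `4` each.
-/

namespace QuantumSearch

noncomputable section

section Unitary

variable {ι : Type*} [Fintype ι] [DecidableEq ι]

theorem toEuclideanLin_mul_apply (A B : Matrix ι ι ℂ) (v : EuclideanSpace ℂ ι) :
    Matrix.toEuclideanLin (A * B) v = Matrix.toEuclideanLin A (Matrix.toEuclideanLin B v) := by
  simp only [Matrix.toLpLin_mul_same, LinearMap.comp_apply]

theorem inner_toEuclideanLin {A : Matrix ι ι ℂ} (hA : A ∈ Matrix.unitaryGroup ι ℂ)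
    (v w : EuclideanSpace ℂ ι) :
    inner ℂ (Matrix.toEuclideanLin A v) (Matrix.toEuclideanLin A w) = inner ℂ v w := by
  rw [← LinearMap.adjoint_inner_right, ← Matrix.toEuclideanLin_conjTranspose_eq_adjoint,
    ← toEuclideanLin_mul_apply, ← Matrix.star_eq_conjTranspose, hA.1, Matrix.toLpLin_one,
    LinearMap.id_apply]

theorem norm_toEuclideanLin {A : Matrix ι ι ℂ} (hA : A ∈ Matrix.unitaryGroup ι ℂ)
    (v : EuclideanSpace ℂ ι) : ‖Matrix.toEuclideanLin A v‖ = ‖v‖ :=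
  (LinearMap.norm_map_iff_inner_map_map (𝕜 := ℂ) (Matrix.toEuclideanLin A)).mpr
    (inner_toEuclideanLin hA) v

theorem diagonal_mem_unitaryGroup {d : ι → ℂ} (hd : ∀ i, ‖d i‖ = 1) :
    Matrix.diagonal d ∈ Matrix.unitaryGroup ι ℂ := by
  rw [Matrix.mem_unitaryGroup_iff', Matrix.star_eq_conjTranspose, Matrix.diagonal_conjTranspose,
    Matrix.diagonal_mul_diagonal, ← Matrix.diagonal_one]
  congr 1
  funext i
  rw [Pi.star_apply, Complex.star_def, Complex.conj_mul', hd]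
  norm_num

end Unitary

section PiKronecker

variable {κ α : Type*} [Fintype κ]

/-- The Kronecker product `⨂ s, V s` of a family of square matrices of the same size, acting on
functions `κ → α` as basis states; a register of qubits and the workspace are both of this form. -/
def piKronecker {R : Type*} [CommMonoid R] (V : κ → Matrix α α R) : Matrix (κ → α) (κ → α) R :=
  fun y x => ∏ s, V s (y s) (x s)

section CommSemiring

variable {R : Type*} [CommSemiring R]

theorem piKronecker_mul [DecidableEq κ] [Fintype α] (V W : κ → Matrix α α R) :
    piKronecker V * piKronecker W = piKronecker (fun s => V s * W s) := by
  ext y x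
  simp only [Matrix.mul_apply, piKronecker, ← Finset.prod_mul_distrib, Fintype.prod_sum]

theorem piKronecker_diagonal [DecidableEq α] (d : κ → α → R) :
    piKronecker (fun s => Matrix.diagonal (d s))
      = Matrix.diagonal (fun x => ∏ s, d s (x s)) := by
  ext y x
  simp only [piKronecker, Matrix.diagonal_apply, Finset.prod_ite_zero, Finset.mem_univ,
    true_imp_iff, funext_iff]

theorem piKronecker_one [DecidableEq α] :
    piKronecker (fun _ : κ => (1 : Matrix α α R)) = 1 := by
  simpa only [← Matrix.diagonal_one, Finset.prod_const_one] using
    piKronecker_diagonal (fun (_ : κ) (_ : α) => (1 : R))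

end CommSemiring

theorem piKronecker_conjTranspose (V : κ → Matrix α α ℂ) :
    (piKronecker V)ᴴ = piKronecker (fun s => (V s)ᴴ) := by
  ext y x
  simp only [Matrix.conjTranspose_apply, piKronecker, star_prod]

theorem piKronecker_mem_unitaryGroup [DecidableEq κ] [Fintype α] [DecidableEq α]
    {V : κ → Matrix α α ℂ} (hV : ∀ s, V s ∈ Matrix.unitaryGroup α ℂ) :
    piKronecker V ∈ Matrix.unitaryGroup (κ → α) ℂ := by
  rw [Matrix.mem_unitaryGroup_iff', Matrix.star_eq_conjTranspose, piKronecker_conjTranspose,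
    piKronecker_mul, ← piKronecker_one]
  congr 1
  funext s
  exact (hV s).1

end PiKronecker

section MajorityTail

variable {κ α : Type*} [Fintype κ]

theorem one_le_prod_ite_inv {P : κ → Prop} [DecidablePred P] {s : ℝ} (hs : 0 < s) (hs1 : s ≤ 1)
    (hP : Fintype.card κ ≤ 2 * (Finset.univ.filter P).card) :
    1 ≤ ∏ r, if P r then s⁻¹ else s := by
  have hcard : (Finset.univ.filter fun r => ¬P r).card ≤ (Finset.univ.filter P).card := by
    have := Finset.card_filter_add_card_filter_not (s := Finset.univ) P
    rw [Finset.card_univ] at this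
    omega
  rw [Finset.prod_ite, Finset.prod_const, Finset.prod_const, inv_pow, inv_mul_eq_div,
    one_le_div (by positivity)]
  exact pow_le_pow_of_le_one hs.le hs1 hcard

/-- Weighting the points of `B` by `s⁻¹` and all others by `s` makes every tuple that is in `B` at
least half of the time weigh at least `1`. -/
theorem sum_prod_half_le [DecidableEq κ] [Fintype α] [DecidableEq α] {p : α → ℝ}
    (hp : ∀ y, 0 ≤ p y) (hp1 : ∑ y, p y ≤ 1) {B : Finset α} {s : ℝ} (hs : 0 < s) (hs1 : s ≤ 1)
    (hB : ∑ y ∈ B, p y ≤ s ^ 2) :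
    ∑ x : κ → α with Fintype.card κ ≤ 2 * (Finset.univ.filter fun r => x r ∈ B).card,
      ∏ r, p (x r) ≤ (2 * s) ^ Fintype.card κ := by
  let weight : α → ℝ := fun y => if y ∈ B then s⁻¹ else s
  have hq : ∀ y, 0 ≤ p y * weight y := fun y =>
    mul_nonneg (hp y) (by simp only [weight]; split_ifs <;> positivity)
  have hsplit : ∀ y, p y * weight y ≤ (if y ∈ B then p y else 0) * s⁻¹ + p y * s := fun y => by
    have := mul_nonneg (hp y) hs.le
    simp only [weight]
    split_ifs <;> linarith
  have hsum : ∑ y, p y * weight y ≤ 2 * s :=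
    calc ∑ y, p y * weight y
        ≤ ∑ y, ((if y ∈ B then p y else 0) * s⁻¹ + p y * s) :=
          Finset.sum_le_sum fun y _ => hsplit y
      _ = (∑ y ∈ B, p y) * s⁻¹ + (∑ y, p y) * s := by
          rw [Finset.sum_add_distrib, ← Finset.sum_mul, ← Finset.sum_mul, Finset.sum_ite_mem,
            Finset.univ_inter]
      _ ≤ s ^ 2 * s⁻¹ + 1 * s := by gcongr
      _ = 2 * s := by field_simp; norm_num
  calc _ ≤ ∑ x : κ → α with Fintype.card κ ≤ 2 * (Finset.univ.filter fun r => x r ∈ B).card,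
        ∏ r, p (x r) * weight (x r) := by
        refine Finset.sum_le_sum fun x hx => ?_
        rw [Finset.prod_mul_distrib]
        exact le_mul_of_one_le_right (Finset.prod_nonneg fun r _ => hp _)
          (one_le_prod_ite_inv hs hs1 (Finset.mem_filter.mp hx).2)
    _ ≤ ∑ x : κ → α, ∏ r, p (x r) * weight (x r) := Finset.sum_le_univ_sum_of_nonneg fun x =>
        Finset.prod_nonneg fun r _ => hq _
    _ = (∑ y, p y * weight y) ^ Fintype.card κ := by
        rw [← Fintype.prod_sum (fun _ y => p y * weight y), Finset.prod_const, Finset.card_univ]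
    _ ≤ _ := by gcongr; exact Finset.sum_nonneg fun y _ => hq y

end MajorityTail

section RegisterValue

variable {m : ℕ}

/-- Binary expansion as a bijection between register contents and `{0, …, 2^m - 1}`. -/
def regEquiv (m : ℕ) : Reg m ≃ Fin (2 ^ m) :=
  (Equiv.arrowCongr (Equiv.refl (Fin m)) finTwoEquiv.symm).trans finFunctionFinEquiv

theorem regEquiv_val (x : Reg m) : (regEquiv m x : ℕ) = regValue x := by
  rw [regEquiv, Equiv.trans_apply, finFunctionFinEquiv_apply_val, regValue]
  refine Finset.sum_congr rfl fun i _ => ?_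
  simp only [Equiv.arrowCongr_apply, Function.comp]
  cases h : x i <;> simp [h, finTwoEquiv]

theorem regValue_lt (x : Reg m) : regValue x < 2 ^ m := by
  rw [← regEquiv_val]
  exact (regEquiv m x).isLt

theorem regValue_injective : Function.Injective (regValue (m := m)) := fun x y h =>
  (regEquiv m).injective (Fin.ext (by simpa only [regEquiv_val] using h))

theorem sum_regValue {M : Type*} [AddCommMonoid M] (f : ℕ → M) :
    ∑ x : Reg m, f (regValue x) = ∑ j ∈ Finset.range (2 ^ m), f j := by
  rw [← Fin.sum_univ_eq_sum_range, ← (regEquiv m).sum_comp]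
  simp only [regEquiv_val]

end RegisterValue

section FourierTransform

theorem sum_range_pow_zpow_of_isPrimitiveRoot {K : Type*} [Field K] {ζ : K} {N : ℕ}
    (hζ : IsPrimitiveRoot ζ N) (t : ℤ) :
    ∑ j ∈ Finset.range N, (ζ ^ t) ^ j = if (N : ℤ) ∣ t then (N : K) else 0 := by
  split_ifs with h
  · rw [(hζ.zpow_eq_one_iff_dvd t).mpr h]
    simp only [one_pow, Finset.sum_const, Finset.card_range, nsmul_eq_mul, mul_one]
  · rw [geom_sum_eq (mt (hζ.zpow_eq_one_iff_dvd t).mp h), ← zpow_natCast, zpow_comm, zpow_natCast,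
      hζ.pow_eq_one, one_zpow, sub_self, zero_div]

theorem ofReal_sqrt_mul_self {x : ℝ} (hx : 0 ≤ x) : (√x : ℂ) * (√x : ℂ) = x := by
  rw [← Complex.ofReal_mul, Real.mul_self_sqrt hx]

variable {m : ℕ}

/-- The primitive `2^m`-th root of unity `e^{2πi/2^m}` of the Fourier transform modulo `2^m`. -/
def qftRoot (m : ℕ) : ℂ := Complex.exp (2 * Real.pi * Complex.I / (2 ^ m : ℕ))

theorem isPrimitiveRoot_qftRoot (m : ℕ) : IsPrimitiveRoot (qftRoot m) (2 ^ m) :=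
  Complex.isPrimitiveRoot_exp _ (by positivity)

theorem qftRoot_ne_zero (m : ℕ) : qftRoot m ≠ 0 := Complex.exp_ne_zero _

theorem star_qftRoot (m : ℕ) : star (qftRoot m) = (qftRoot m)⁻¹ :=
  (Complex.inv_eq_conj ((isPrimitiveRoot_qftRoot m).norm'_eq_one (by positivity))).symm

theorem qftRoot_zpow (m : ℕ) (t : ℤ) :
    qftRoot m ^ t = Complex.exp ((2 * Real.pi * t / 2 ^ m : ℝ) * Complex.I) := by
  rw [qftRoot, ← Complex.exp_int_mul]
  congr 1
  push_cast
  ring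

theorem invQFT_apply (y x : Reg m) :
    invQFT m y x = (qftRoot m ^ (-(regValue y : ℤ))) ^ regValue x / (√(2 ^ m) : ℂ) := by
  rw [invQFT, qftRoot_zpow, ← Complex.exp_nat_mul]
  congr 2
  push_cast
  ring

theorem invQFT_mem_unitaryGroup (m : ℕ) : invQFT m ∈ Matrix.unitaryGroup (Reg m) ℂ := by
  rw [Matrix.mem_unitaryGroup_iff', Matrix.star_eq_conjTranspose]
  ext y x
  have hterm : ∀ w, (invQFT m)ᴴ y w * invQFT m w x
      = (qftRoot m ^ ((regValue y : ℤ) - regValue x)) ^ regValue w / (2 ^ m : ℕ) := fun w => by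
    have hroot := qftRoot_ne_zero m
    have hsqrt := ofReal_sqrt_mul_self (x := 2 ^ m) (by positivity)
    simp only [Matrix.conjTranspose_apply, invQFT_apply, star_div₀, star_pow, star_zpow₀,
      star_qftRoot, Complex.star_def, Complex.conj_ofReal]
    rw [div_mul_div_comm, hsqrt, inv_zpow', neg_neg, sub_eq_add_neg, zpow_add₀ hroot]
    push_cast
    congr 1
    simp only [← zpow_natCast, ← zpow_mul, mul_zpow]
    congr 2 <;> ring
  have hdvd : ((2 ^ m : ℕ) : ℤ) ∣ (regValue y : ℤ) - regValue x ↔ y = x := by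
    refine ⟨fun h => regValue_injective ?_, fun h => by rw [h, sub_self]; exact dvd_zero _⟩
    have := regValue_lt y
    have := regValue_lt x
    have := Int.eq_zero_of_abs_lt_dvd h (by rw [abs_lt]; omega)
    omega
  rw [Matrix.mul_apply, Finset.sum_congr rfl fun w _ => hterm w, ← Finset.sum_div,
    sum_regValue (fun j => (qftRoot m ^ ((regValue y : ℤ) - regValue x)) ^ j),
    sum_range_pow_zpow_of_isPrimitiveRoot (isPrimitiveRoot_qftRoot m), Matrix.one_apply]
  simp only [hdvd]
  split_ifs
  · exact div_self (by exact_mod_cast (by positivity : (2 ^ m : ℕ) ≠ 0))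
  · exact zero_div _

end FourierTransform

section EstimatedPhase

variable {m : ℕ}

/-- The representative in `(-2^(m-1), 2^(m-1)]` of the value of a register modulo `2^m`, so that
the estimated phase is `2π/2^m` times it. -/
def signedValue (y : Reg m) : ℤ :=
  if 2 * regValue y ≤ 2 ^ m then regValue y else regValue y - (2 ^ m : ℕ)

theorem estimatedPhase_eq (y : Reg m) : estimatedPhase y = 2 * Real.pi * signedValue y / 2 ^ m := by
  rw [estimatedPhase, signedValue]
  split_ifs
  · rw [Int.cast_natCast]
  · push_cast
    field_simp

theorem estimatedPhase_neg_iff (y : Reg m) : estimatedPhase y < 0 ↔ signedValue y < 0 := by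
  rw [estimatedPhase_eq, div_lt_iff₀ (by positivity), zero_mul, ← smul_eq_mul,
    smul_neg_iff_of_pos_left Real.two_pi_pos, Int.cast_lt_zero]

theorem two_mul_natAbs_signedValue_le (y : Reg m) : 2 * (signedValue y).natAbs ≤ 2 ^ m := by
  have := regValue_lt y
  rw [signedValue]
  split_ifs <;> omega

theorem signedValue_injective : Function.Injective (signedValue (m := m)) := fun x y h => by
  have := regValue_lt x
  have := regValue_lt y
  refine regValue_injective ?_
  simp only [signedValue] at h
  split_ifs at h <;> omega

theorem qftRoot_zpow_signedValue (y : Reg m) :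
    qftRoot m ^ signedValue y = qftRoot m ^ regValue y := by
  rw [signedValue]
  split_ifs
  · exact zpow_natCast _ _
  · rw [zpow_sub₀ (qftRoot_ne_zero m), zpow_natCast, zpow_natCast,
      (isPrimitiveRoot_qftRoot m).pow_eq_one, div_one]

theorem abs_estimatedPhase (y : Reg m) :
    |estimatedPhase y| = 2 * Real.pi * (signedValue y).natAbs / 2 ^ m := by
  rw [estimatedPhase_eq, abs_div, abs_mul, abs_of_pos Real.two_pi_pos, Nat.cast_natAbs,
    Int.cast_abs, abs_of_pos (by positivity : (0 : ℝ) < 2 ^ m)]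

theorem abs_estimatedPhase_le (y : Reg m) : |estimatedPhase y| ≤ Real.pi := by
  have h : (2 * (signedValue y).natAbs : ℝ) ≤ 2 ^ m := by
    exact_mod_cast two_mul_natAbs_signedValue_le y
  rw [abs_estimatedPhase, div_le_iff₀ (by positivity), mul_right_comm, mul_comm Real.pi]
  gcongr

end EstimatedPhase

section PhaseEstimation

variable {m : ℕ}

/-- The Hadamard gate on one qubit. -/
def hadamardGate : Matrix Bool Bool ℂ :=
  fun y x => (if y = true ∧ x = true then -1 else 1) / (√2 : ℂ)

theorem hadamardGate_mem_unitaryGroup : hadamardGate ∈ Matrix.unitaryGroup Bool ℂ := by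
  have hsqrt : (√2 : ℂ)⁻¹ * (√2 : ℂ)⁻¹ = 2⁻¹ := by
    rw [← mul_inv, ofReal_sqrt_mul_self zero_le_two, Complex.ofReal_ofNat]
  rw [Matrix.mem_unitaryGroup_iff', Matrix.star_eq_conjTranspose]
  ext y x
  cases y <;> cases x <;>
    simp [Matrix.mul_apply, hadamardGate, div_eq_mul_inv, hsqrt, ← two_mul]

theorem hadamard_eq_piKronecker (m : ℕ) : hadamard m = piKronecker fun _ => hadamardGate := rfl

theorem hadamard_mem_unitaryGroup (m : ℕ) : hadamard m ∈ Matrix.unitaryGroup (Reg m) ℂ := by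
  rw [hadamard_eq_piKronecker]
  exact piKronecker_mem_unitaryGroup fun _ => hadamardGate_mem_unitaryGroup

theorem hadamard_zero (x : Reg m) : hadamard m x (fun _ => false) = (√(2 ^ m) : ℂ)⁻¹ := by
  have hsqrt : √(2 ^ m) = √2 ^ m := by
    rw [Real.sqrt_eq_iff_mul_self_eq (by positivity) (by positivity), ← mul_pow,
      Real.mul_self_sqrt (by norm_num)]
  simp [hadamard, hsqrt]

/-- The action of phase estimation on a register next to an eigenvector of `U` with
eigenvalue `z`. -/
def estimateMat (m : ℕ) (z : ℂ) : Matrix (Reg m) (Reg m) ℂ :=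
  invQFT m * Matrix.diagonal (fun x => z ^ regValue x) * hadamard m

theorem estimateMat_mem_unitaryGroup (m : ℕ) {z : ℂ} (hz : ‖z‖ = 1) :
    estimateMat m z ∈ Matrix.unitaryGroup (Reg m) ℂ :=
  mul_mem (mul_mem (invQFT_mem_unitaryGroup m)
    (diagonal_mem_unitaryGroup fun x => by rw [norm_pow, hz, one_pow]))
    (hadamard_mem_unitaryGroup m)

/-- The amplitude of the outcome `y` of phase estimation on a register for an eigenvalue `z`. -/
def amplitude (m : ℕ) (z : ℂ) (y : Reg m) : ℂ := estimateMat m z y (fun _ => false)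

theorem amplitude_eq_sum (m : ℕ) (z : ℂ) (y : Reg m) :
    amplitude m z y
      = (∑ j ∈ Finset.range (2 ^ m), (z * qftRoot m ^ (-signedValue y)) ^ j) / 2 ^ m := by
  have hsqrt := ofReal_sqrt_mul_self (x := 2 ^ m) (by positivity)
  push_cast at hsqrt
  rw [zpow_neg, qftRoot_zpow_signedValue, ← zpow_natCast, ← zpow_neg,
    ← sum_regValue fun j => (z * qftRoot m ^ (-(regValue y : ℤ))) ^ j, Finset.sum_div,
    amplitude, estimateMat, Matrix.mul_apply]
  refine Finset.sum_congr rfl fun x _ => ?_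
  rw [Matrix.mul_diagonal, invQFT_apply, hadamard_zero, mul_pow, ← hsqrt]
  ring

theorem sum_norm_sq_col {n : Type*} [Fintype n] [DecidableEq n] {A : Matrix n n ℂ}
    (hA : A ∈ Matrix.unitaryGroup n ℂ) (x : n) : ∑ y, ‖A y x‖ ^ 2 = 1 := by
  have h := congrFun₂ hA.1 x x
  simp only [Matrix.star_eq_conjTranspose, Matrix.mul_apply, Matrix.conjTranspose_apply,
    Complex.star_def, Complex.conj_mul', Matrix.one_apply_eq] at h
  exact_mod_cast h

theorem sum_norm_sq_amplitude (m : ℕ) {z : ℂ} (hz : ‖z‖ = 1) : ∑ y, ‖amplitude m z y‖ ^ 2 = 1 :=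
  sum_norm_sq_col (estimateMat_mem_unitaryGroup m hz) _

end PhaseEstimation

/-! ### Accuracy of phase estimation -/

section DirichletKernel

theorem mul_le_sin_of_le_three_quarters {t : ℝ} (h0 : 0 ≤ t) (h1 : t ≤ 3 * Real.pi / 4) :
    2 / (3 * Real.pi) * t ≤ Real.sin t := by
  have hpi := Real.pi_pos
  rcases le_total t (Real.pi / 2) with h | h
  · refine le_trans ?_ (Real.mul_le_sin h0 h)
    gcongr
    linarith
  · rw [← Real.sin_pi_sub]
    refine le_trans ?_ (Real.mul_le_sin (by linarith) (by linarith))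
    rw [div_mul_eq_mul_div, div_mul_eq_mul_div, div_le_div_iff₀ (by positivity) hpi]
    nlinarith

theorem le_norm_exp_sub_one {θ : ℝ} (hθ : |θ| ≤ 3 * Real.pi / 2) :
    2 * |θ| / (3 * Real.pi) ≤ ‖Complex.exp (θ * Complex.I) - 1‖ := by
  have hsin : 2 / (3 * Real.pi) * (|θ| / 2) ≤ |Real.sin (θ / 2)| := by
    have h := mul_le_sin_of_le_three_quarters (t := |θ| / 2) (by positivity) (by linarith)
    rcases abs_cases θ with ⟨hcase, -⟩ | ⟨hcase, -⟩ <;> rw [hcase] at h ⊢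
    · exact h.trans (le_abs_self _)
    · rw [neg_div, Real.sin_neg, ← neg_div] at h
      exact h.trans (neg_le_abs _)
  rw [mul_comm (θ : ℂ), Complex.norm_exp_I_mul_ofReal_sub_one, norm_mul, Real.norm_eq_abs,
    Real.norm_eq_abs, abs_two]
  calc 2 * |θ| / (3 * Real.pi) = 2 * (2 / (3 * Real.pi) * (|θ| / 2)) := by ring
    _ ≤ 2 * |Real.sin (θ / 2)| := by gcongr

theorem norm_geom_sum_exp_le {θ : ℝ} (h0 : θ ≠ 0) (h1 : |θ| ≤ 3 * Real.pi / 2) (N : ℕ) :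
    ‖∑ j ∈ Finset.range N, Complex.exp (θ * Complex.I) ^ j‖ ≤ 3 * Real.pi / |θ| := by
  have hlow := le_norm_exp_sub_one h1
  have hpos : 0 < 2 * |θ| / (3 * Real.pi) := by positivity
  have hne : Complex.exp (θ * Complex.I) ≠ 1 :=
    sub_ne_zero.mp (norm_pos_iff.mp (hpos.trans_le hlow))
  have hup : ‖Complex.exp (θ * Complex.I) ^ N - 1‖ ≤ 2 := by
    refine (norm_sub_le _ _).trans ?_
    rw [norm_pow, Complex.norm_exp_ofReal_mul_I, one_pow, norm_one]
    norm_num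
  rw [geom_sum_eq hne, norm_div]
  calc _ ≤ 2 / (2 * |θ| / (3 * Real.pi)) := by gcongr
    _ = 3 * Real.pi / |θ| := by field_simp

theorem sum_one_div_add_sq_le {x : ℝ} (hx : 1 < x) (M : ℕ) :
    ∑ j ∈ Finset.range M, 1 / (x + j) ^ 2 ≤ 1 / (x - 1) := by
  have htelescope : ∀ j : ℕ, 1 / (x + j) ^ 2 ≤ 1 / (x + j - 1) - 1 / (x + (j + 1 : ℕ) - 1) :=
    fun j => by
      have : (0 : ℝ) ≤ j := Nat.cast_nonneg j
      have h1 : 0 < x + j - 1 := by linarith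
      have h2 : 0 < x + j := by linarith
      rw [show x + (j + 1 : ℕ) - 1 = x + j by push_cast; ring, div_sub_div _ _ h1.ne' h2.ne',
        div_le_div_iff₀ (by positivity) (by positivity)]
      nlinarith
  have hlast : 0 < 1 / (x + M - 1) :=
    one_div_pos.mpr (by linarith [(Nat.cast_nonneg M : (0 : ℝ) ≤ M)])
  calc _ ≤ ∑ j ∈ Finset.range M, (1 / (x + j - 1) - 1 / (x + (j + 1 : ℕ) - 1)) :=
        Finset.sum_le_sum fun j _ => htelescope j
    _ = 1 / (x + (0 : ℕ) - 1) - 1 / (x + M - 1) :=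
        Finset.sum_range_sub' (fun j : ℕ => 1 / (x + j - 1)) M
    _ ≤ 1 / (x - 1) := by rw [Nat.cast_zero, add_zero]; linarith

end DirichletKernel

section Misread

variable {m : ℕ}

theorem norm_amplitude_le {z : ℂ} (hz : ‖z‖ = 1) (y : Reg m) (h0 : z.arg - estimatedPhase y ≠ 0)
    (h1 : |z.arg - estimatedPhase y| ≤ 3 * Real.pi / 2) :
    ‖amplitude m z y‖ ≤ 3 * Real.pi / (2 ^ m * |z.arg - estimatedPhase y|) := by
  have hexp : z * qftRoot m ^ (-signedValue y)
      = Complex.exp ((z.arg - estimatedPhase y : ℝ) * Complex.I) := by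
    have hpolar : Complex.exp (z.arg * Complex.I) = z := by
      simpa only [hz, Complex.ofReal_one, one_mul] using Complex.norm_mul_exp_arg_mul_I z
    rw [qftRoot_zpow, estimatedPhase_eq, Complex.ofReal_sub, sub_mul, sub_eq_add_neg,
      Complex.exp_add, hpolar]
    congr 2
    push_cast
    ring
  rw [amplitude_eq_sum, hexp, norm_div, norm_pow, Complex.norm_ofNat, mul_comm (2 ^ m : ℝ),
    ← div_div]
  gcongr
  exact norm_geom_sum_exp_le h0 h1 _

/-- The outcomes of phase estimation that give the wrong sign for the phase of `z`. The phase `0`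
counts as positive, in accordance with the `U`-rotation. -/
def misread (m : ℕ) (z : ℂ) : Finset (Reg m) :=
  Finset.univ.filter fun y => signedValue y < 0 ↔ 0 ≤ z.arg

theorem mem_misread {z : ℂ} {y : Reg m} : y ∈ misread m z ↔ (signedValue y < 0 ↔ 0 ≤ z.arg) := by
  rw [misread, Finset.mem_filter, and_iff_right (Finset.mem_univ y)]

theorem injOn_natAbs_signedValue_misread (z : ℂ) :
    Set.InjOn (fun y => (signedValue y).natAbs) (misread m z : Set (Reg m)) := by
  intro x hx y hy h
  rw [Finset.mem_coe, mem_misread] at hx hy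
  have hsign := hx.trans hy.symm
  exact signedValue_injective (by dsimp only at h; omega)

theorem abs_arg_sub_estimatedPhase {z : ℂ} {y : Reg m} (hy : y ∈ misread m z) :
    |z.arg - estimatedPhase y| = |z.arg| + |estimatedPhase y| := by
  rw [mem_misread, ← estimatedPhase_neg_iff] at hy
  rcases le_or_gt 0 z.arg with harg | harg
  · have hphase := hy.mpr harg
    rw [abs_of_nonneg (by linarith), abs_of_nonneg harg, abs_of_neg hphase, sub_eq_add_neg]
  · have hphase := not_lt.mp (mt hy.mp harg.not_ge)
    rw [abs_of_nonpos (by linarith), abs_of_neg harg, abs_of_nonneg hphase, neg_sub']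
    ring

theorem norm_sq_amplitude_misread_le {z : ℂ} (hz : ‖z‖ = 1) (harg0 : z.arg ≠ 0)
    (harg : |z.arg| ≤ Real.pi / 2) {y : Reg m} (hy : y ∈ misread m z) :
    ‖amplitude m z y‖ ^ 2
      ≤ 9 / 4 * (1 / (2 ^ m * |z.arg| / (2 * Real.pi) + (signedValue y).natAbs) ^ 2) := by
  have : 0 < |z.arg| := abs_pos.mpr harg0
  have hdist := abs_arg_sub_estimatedPhase hy
  have hle := abs_estimatedPhase_le y
  have hamp := norm_amplitude_le hz y (abs_pos.mp (by rw [hdist]; positivity))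
    (by rw [hdist]; linarith)
  calc ‖amplitude m z y‖ ^ 2 ≤ (3 * Real.pi / (2 ^ m * |z.arg - estimatedPhase y|)) ^ 2 := by gcongr
    _ = _ := by
      rw [hdist, abs_estimatedPhase]
      field_simp
      norm_num

theorem sum_misread_le_of_one_lt {z : ℂ} (hz : ‖z‖ = 1) (harg : |z.arg| ≤ Real.pi / 2)
    (hprec : 1 < 2 ^ m * |z.arg| / (2 * Real.pi)) :
    ∑ y ∈ misread m z, ‖amplitude m z y‖ ^ 2
      ≤ 9 / 4 * (1 / (2 ^ m * |z.arg| / (2 * Real.pi) - 1)) := by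
  set x : ℝ := 2 ^ m * |z.arg| / (2 * Real.pi) with hx
  have harg0 : z.arg ≠ 0 := fun h => by
    rw [hx, h, abs_zero, mul_zero, zero_div] at hprec
    exact hprec.not_ge zero_le_one
  calc _ ≤ ∑ y ∈ misread m z, 9 / 4 * (1 / (x + (signedValue y).natAbs) ^ 2) :=
        Finset.sum_le_sum fun y hy => norm_sq_amplitude_misread_le hz harg0 harg hy
    _ = 9 / 4 * ∑ n ∈ (misread m z).image fun y => (signedValue y).natAbs, 1 / (x + n) ^ 2 := by
        rw [Finset.sum_image (injOn_natAbs_signedValue_misread z), Finset.mul_sum]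
    _ ≤ 9 / 4 * ∑ n ∈ Finset.range (2 ^ m + 1), 1 / (x + n) ^ 2 := by
        refine mul_le_mul_of_nonneg_left (Finset.sum_le_sum_of_subset_of_nonneg
          (Finset.image_subset_iff.mpr fun y _ => ?_) fun n _ _ => by positivity) (by norm_num)
        have := two_mul_natAbs_signedValue_le y
        exact Finset.mem_range.mpr (by omega)
    _ ≤ 9 / 4 * (1 / (x - 1)) := by gcongr; exact sum_one_div_add_sq_le hprec _

theorem amplitude_one_eq_zero {y : Reg m} (hy : y ∈ misread m 1) : amplitude m 1 y = 0 := by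
  have hneg : signedValue y < 0 := (mem_misread.mp hy).mpr (by rw [Complex.arg_one])
  have hle := two_mul_natAbs_signedValue_le y
  have hdvd : ¬((2 ^ m : ℕ) : ℤ) ∣ -signedValue y := fun h => by
    have := Int.le_of_dvd (by omega) h
    omega
  simp only [amplitude_eq_sum, one_mul]
  rw [sum_range_pow_zpow_of_isPrimitiveRoot (isPrimitiveRoot_qftRoot m), if_neg hdvd, zero_div]

theorem sum_misread_le {z : ℂ} (hz : ‖z‖ = 1) (harg : |z.arg| ≤ Real.pi / 2)
    (hprec : z = 1 ∨ 74 * Real.pi ≤ 2 ^ m * |z.arg|) :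
    ∑ y ∈ misread m z, ‖amplitude m z y‖ ^ 2 ≤ (1 / 4) ^ 2 := by
  rcases hprec with rfl | hprec
  · rw [Finset.sum_eq_zero fun y hy => by
      rw [amplitude_one_eq_zero hy, norm_zero, zero_pow two_ne_zero]]
    positivity
  · have hx : 37 ≤ 2 ^ m * |z.arg| / (2 * Real.pi) := by
      rw [le_div_iff₀ Real.two_pi_pos]
      linarith
    refine (sum_misread_le_of_one_lt hz harg (by linarith)).trans ?_
    calc 9 / 4 * (1 / (2 ^ m * |z.arg| / (2 * Real.pi) - 1)) ≤ 9 / 4 * (1 / 36) := by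
          gcongr
          linarith
      _ = (1 / 4) ^ 2 := by norm_num

end Misread

/-! ### Circuits on an eigenvector -/

section Workspace

variable {k m : ℕ}

/-- The action of a gate on the workspace next to an eigenvector of a unitary `U` with
eigenvalue `z`. -/
def Gate.workspaceMat (z : ℂ) : Gate k m → Matrix (Work k m) (Work k m) ℂ
  | work W => W
  | ctrl r i => Matrix.diagonal (fun x => if x r i = true then z else 1)
  | ctrlInv r i => Matrix.diagonal (fun x => if x r i = true then star z else 1)

/-- The action of a circuit on the workspace next to an eigenvector of a unitary `U` with
eigenvalue `z`. -/
def Circuit.workspaceMat (z : ℂ) : Circuit k m → Matrix (Work k m) (Work k m) ℂ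
  | [] => 1
  | g :: c => workspaceMat z c * g.workspaceMat z

theorem Gate.workspaceMat_adjoint (z : ℂ) (g : Gate k m) :
    g.adjoint.workspaceMat z = (g.workspaceMat z)ᴴ := by
  cases g with
  | work W => rfl
  | ctrl r i | ctrlInv r i =>
    rw [adjoint, workspaceMat, workspaceMat, Matrix.diagonal_conjTranspose]
    congr 1
    funext x
    rw [Pi.star_apply, apply_ite star]
    simp only [star_one, star_star]

namespace Circuit

theorem workspaceMat_singleton (z : ℂ) (g : Gate k m) :
    workspaceMat z [g] = g.workspaceMat z :=
  one_mul _

theorem workspaceMat_append (z : ℂ) (c d : Circuit k m) :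
    workspaceMat z (c ++ d) = workspaceMat z d * workspaceMat z c := by
  induction c with
  | nil => exact (mul_one _).symm
  | cons g c ih => rw [List.cons_append, workspaceMat, workspaceMat, ih, mul_assoc]

theorem undo_cons (g : Gate k m) (c : Circuit k m) : undo (g :: c) = undo c ++ [g.adjoint] := by
  rw [undo, List.map_cons, List.reverse_cons, undo]

theorem workspaceMat_undo (z : ℂ) (c : Circuit k m) :
    workspaceMat z c.undo = (workspaceMat z c)ᴴ := by
  induction c with
  | nil => exact Matrix.conjTranspose_one.symm
  | cons g c ih =>
    rw [undo_cons, workspaceMat_append, workspaceMat_singleton, ih, workspaceMat,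
      Gate.workspaceMat_adjoint, Matrix.conjTranspose_mul]

theorem workspaceMat_replicate (z : ℂ) (g : Gate k m) (n : ℕ) :
    workspaceMat z (List.replicate n g) = g.workspaceMat z ^ n := by
  induction n with
  | zero => rfl
  | succ n ih => rw [List.replicate_succ, workspaceMat, ih, pow_succ]

theorem workspaceMat_controlledPowers (z : ℂ) (r : Fin k) (l : List (Fin m)) :
    workspaceMat z (l.flatMap fun i : Fin m => List.replicate (2 ^ (i : ℕ)) (Gate.ctrl r i))
      = Matrix.diagonal (fun x : Work k m =>
          z ^ (l.map fun i => if x r i = true then 2 ^ (i : ℕ) else 0).sum) := by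
  induction l with
  | nil => simp [workspaceMat]
  | cons i l ih =>
    rw [List.flatMap_cons, workspaceMat_append, ih, workspaceMat_replicate, Gate.workspaceMat,
      Matrix.diagonal_pow, Matrix.diagonal_mul_diagonal]
    congr 1
    ext x
    simp only [Pi.pow_apply, List.map_cons, List.sum_cons, pow_add]
    split_ifs <;> simp [mul_comm]

end Circuit

theorem onRegister_eq_piKronecker (r : Fin k) (V : Matrix (Reg m) (Reg m) ℂ) :
    onRegister r V = piKronecker (Pi.mulSingle r V) := by
  ext y x
  have hfactor : ∀ s, (Pi.mulSingle r V : Fin k → Matrix (Reg m) (Reg m) ℂ) s (y s) (x s)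
      = if s = r then V (y r) (x r) else if y s = x s then 1 else 0 := fun s => by
    by_cases hs : s = r
    · subst hs
      rw [Pi.mulSingle_eq_same, if_pos rfl]
    · rw [Pi.mulSingle_eq_of_ne hs, Matrix.one_apply, if_neg hs]
  rw [piKronecker, Fintype.prod_congr _ _ hfactor, ← Finset.mul_prod_erase _ _ (Finset.mem_univ r),
    if_pos rfl, Finset.prod_congr rfl fun s hs => if_neg (Finset.ne_of_mem_erase hs),
    Finset.prod_ite_zero, Finset.prod_const_one, mul_ite, mul_one, mul_zero, onRegister]
  simp only [Finset.mem_erase, Finset.mem_univ, and_true]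

theorem onRegister_mul (r : Fin k) (V W : Matrix (Reg m) (Reg m) ℂ) :
    onRegister r V * onRegister r W = onRegister r (V * W) := by
  rw [onRegister_eq_piKronecker, onRegister_eq_piKronecker, piKronecker_mul,
    onRegister_eq_piKronecker, Pi.mulSingle_mul]
  rfl

theorem onRegister_diagonal (r : Fin k) (d : Reg m → ℂ) :
    onRegister r (Matrix.diagonal d) = Matrix.diagonal (fun x : Work k m => d (x r)) := by
  have hfamily : (Pi.mulSingle r (Matrix.diagonal d) : Fin k → Matrix (Reg m) (Reg m) ℂ)
      = fun s => Matrix.diagonal (if s = r then d else 1) := by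
    funext s
    by_cases hs : s = r
    · subst hs
      rw [Pi.mulSingle_eq_same, if_pos rfl]
    · rw [Pi.mulSingle_eq_of_ne hs, if_neg hs]
      exact Matrix.diagonal_one.symm
  rw [onRegister_eq_piKronecker, hfamily, piKronecker_diagonal]
  congr 1
  funext x
  rw [Finset.prod_eq_single_of_mem r (Finset.mem_univ r) fun s _ hs => by rw [if_neg hs]; rfl,
    if_pos rfl]

theorem workspaceMat_estimate (z : ℂ) (r : Fin k) :
    Circuit.workspaceMat z (estimate (m := m) r) = onRegister r (estimateMat m z) := by
  have hpowers : (Matrix.diagonal fun x : Work k m =>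
      z ^ ((List.finRange m).map fun i => if x r i = true then 2 ^ (i : ℕ) else 0).sum)
      = onRegister r (Matrix.diagonal fun x => z ^ regValue x) := by
    rw [onRegister_diagonal]
    rfl
  rw [estimate, Circuit.workspaceMat_append, Circuit.workspaceMat_append,
    Circuit.workspaceMat_controlledPowers, hpowers, Circuit.workspaceMat_singleton,
    Circuit.workspaceMat_singleton]
  simp only [Gate.workspaceMat, onRegister_mul, estimateMat, mul_assoc]

theorem workspaceMat_flatMap_estimate (z : ℂ) {l : List (Fin k)} (hl : l.Nodup) :
    Circuit.workspaceMat z (l.flatMap (estimate (m := m)))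
      = piKronecker fun s => if s ∈ l then estimateMat m z else 1 := by
  induction l with
  | nil =>
    simp only [List.not_mem_nil, if_false, piKronecker_one]
    rfl
  | cons r l ih =>
    rw [List.flatMap_cons, Circuit.workspaceMat_append, workspaceMat_estimate, ih hl.of_cons,
      onRegister_eq_piKronecker, piKronecker_mul]
    congr 1
    funext s
    by_cases hs : s = r
    · subst hs
      rw [if_neg (List.nodup_cons.mp hl).1, one_mul, Pi.mulSingle_eq_same,
        if_pos List.mem_cons_self]
    · simp only [Pi.mulSingle_eq_of_ne hs, mul_one, List.mem_cons, hs, false_or]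

theorem workspaceMat_estimates (z : ℂ) :
    Circuit.workspaceMat z ((List.finRange k).flatMap (estimate (m := m)))
      = piKronecker fun _ => estimateMat m z := by
  simp only [workspaceMat_flatMap_estimate z (List.nodup_finRange k), List.mem_finRange, if_true]

end Workspace

section RotationError

variable {k m : ℕ}

/-- The sign by which `majorityFlip` multiplies the basis state `x`. -/
def majoritySign (x : Work k m) : ℂ :=
  if k < 2 * (Finset.univ.filter fun r : Fin k => estimatedPhase (x r) < 0).card then -1 else 1

/-- The sign by which the rotation of a state multiplies its component of eigenvalue `z`. -/
def phaseSign (z : ℂ) : ℂ := if 0 ≤ z.arg then 1 else -1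

theorem norm_majoritySign (x : Work k m) : ‖majoritySign x‖ = 1 := by
  unfold majoritySign
  split_ifs <;> simp

theorem norm_phaseSign (z : ℂ) : ‖phaseSign z‖ = 1 := by
  unfold phaseSign
  split_ifs <;> simp

theorem majorityFlip_eq_diagonal (k m : ℕ) :
    majorityFlip k m = Matrix.diagonal majoritySign := rfl

theorem le_two_mul_card_misread {z : ℂ} {x : Work k m} (h : majoritySign x ≠ phaseSign z) :
    k ≤ 2 * (Finset.univ.filter fun r => x r ∈ misread m z).card := by
  have hcard := Finset.card_filter_add_card_filter_not (s := (Finset.univ : Finset (Fin k)))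
    fun r => estimatedPhase (x r) < 0
  rw [Finset.card_univ, Fintype.card_fin] at hcard
  simp only [mem_misread, ← estimatedPhase_neg_iff]
  unfold majoritySign phaseSign at h
  by_cases hz : 0 ≤ z.arg
  · simp only [hz, iff_true, if_true] at h ⊢
    by_contra hlt
    exact h (if_neg (by omega))
  · simp only [hz, iff_false, if_false] at h ⊢
    by_contra hlt
    exact h (if_pos (by omega))

theorem workspaceMat_rotateCircuit (k m : ℕ) (z : ℂ) :
    Circuit.workspaceMat z (rotateCircuit k m)
      = (piKronecker fun _ => estimateMat m z)ᴴ *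
          (majorityFlip k m * piKronecker fun _ => estimateMat m z) := by
  rw [rotateCircuit, Circuit.workspaceMat_append, Circuit.workspaceMat_append,
    Circuit.workspaceMat_undo, Circuit.workspaceMat_singleton, workspaceMat_estimates,
    Gate.workspaceMat]

/-- The workspace state `|0…0⟩`. -/
def zeroState (k m : ℕ) : EuclideanSpace ℂ (Work k m) :=
  EuclideanSpace.single (fun _ _ => false) 1

theorem piKronecker_estimateMat_zeroState (z : ℂ) (x : Work k m) :
    Matrix.toEuclideanLin (piKronecker fun _ => estimateMat m z) (zeroState k m) x
      = ∏ r, amplitude m z (x r) := by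
  rw [zeroState, Matrix.toLpLin_apply, PiLp.ofLp_single, Matrix.mulVec_single_one]
  rfl

/-- The error of the rotation procedure on an eigenvector `w` of eigenvalue `z`: the procedure takes
`w ⊗ |0…0⟩` to `phaseSign z • w ⊗ |0…0⟩ + w ⊗ rotationError k m z`. -/
def rotationError (k m : ℕ) (z : ℂ) : EuclideanSpace ℂ (Work k m) :=
  Matrix.toEuclideanLin (Circuit.workspaceMat z (rotateCircuit k m)) (zeroState k m)
    - phaseSign z • zeroState k m

theorem norm_rotationError (k m : ℕ) {z : ℂ} (hz : ‖z‖ = 1) :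
    ‖rotationError k m z‖
      = ‖Matrix.toEuclideanLin (Matrix.diagonal fun x : Work k m => majoritySign x - phaseSign z)
          (Matrix.toEuclideanLin (piKronecker fun _ => estimateMat m z) (zeroState k m))‖ := by
  have hE := piKronecker_mem_unitaryGroup (κ := Fin k) fun _ => estimateMat_mem_unitaryGroup m hz
  rw [← norm_toEuclideanLin hE (rotationError k m z), rotationError, map_sub, map_smul,
    ← toEuclideanLin_mul_apply, workspaceMat_rotateCircuit, ← Matrix.star_eq_conjTranspose,
    ← mul_assoc, Matrix.mem_unitaryGroup_iff.mp hE, one_mul, toEuclideanLin_mul_apply,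
    majorityFlip_eq_diagonal]
  congr 1
  ext x
  simp only [PiLp.sub_apply, PiLp.smul_apply, Matrix.toLpLin_apply, Matrix.mulVec_diagonal,
    smul_eq_mul, sub_mul]

theorem norm_sq_rotationError (k m : ℕ) {z : ℂ} (hz : ‖z‖ = 1) :
    ‖rotationError k m z‖ ^ 2
      = ∑ x : Work k m, ‖majoritySign x - phaseSign z‖ ^ 2 * ∏ r, ‖amplitude m z (x r)‖ ^ 2 := by
  rw [norm_rotationError k m hz, EuclideanSpace.norm_sq_eq]
  refine Finset.sum_congr rfl fun x _ => ?_
  rw [Matrix.toLpLin_apply, PiLp.toLp_apply, Matrix.mulVec_diagonal,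
    piKronecker_estimateMat_zeroState, norm_mul, mul_pow, norm_prod, Finset.prod_pow]

theorem norm_sq_majoritySign_sub_phaseSign_le (x : Work k m) (z : ℂ) :
    ‖majoritySign x - phaseSign z‖ ^ 2 ≤ 4 := by
  have h := norm_sub_le (majoritySign x) (phaseSign z)
  rw [norm_majoritySign, norm_phaseSign] at h
  nlinarith [norm_nonneg (majoritySign x - phaseSign z)]

theorem norm_sq_rotationError_le_four (k m : ℕ) {z : ℂ} (hz : ‖z‖ = 1) :
    ‖rotationError k m z‖ ^ 2 ≤ 4 := by
  rw [norm_sq_rotationError k m hz]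
  calc ∑ x : Work k m, ‖majoritySign x - phaseSign z‖ ^ 2 * ∏ r, ‖amplitude m z (x r)‖ ^ 2
      ≤ ∑ x : Work k m, 4 * ∏ r, ‖amplitude m z (x r)‖ ^ 2 := by
        gcongr with x
        exact norm_sq_majoritySign_sub_phaseSign_le x z
    _ = 4 := by
        rw [← Finset.mul_sum, ← Fintype.prod_sum (fun _ y => ‖amplitude m z y‖ ^ 2),
          Finset.prod_const, sum_norm_sq_amplitude m hz, one_pow, mul_one]

theorem norm_sq_rotationError_le (k : ℕ) {m : ℕ} {z : ℂ} (hz : ‖z‖ = 1)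
    (harg : |z.arg| ≤ Real.pi / 2) (hprec : z = 1 ∨ 74 * Real.pi ≤ 2 ^ m * |z.arg|) :
    ‖rotationError k m z‖ ^ 2 ≤ 4 * (1 / 2) ^ k := by
  have htail := sum_prod_half_le (κ := Fin k) (p := fun y => ‖amplitude m z y‖ ^ 2)
    (fun y => by positivity) (sum_norm_sq_amplitude m hz).le (by norm_num) (by norm_num)
    (sum_misread_le hz harg hprec)
  rw [Fintype.card_fin, show (2 * (1 / 4) : ℝ) = 1 / 2 by norm_num] at htail
  refine le_trans ?_ (mul_le_mul_of_nonneg_left htail zero_le_four)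
  rw [norm_sq_rotationError k m hz, Finset.mul_sum, Finset.sum_filter]
  gcongr with x
  split_ifs with hx
  · gcongr
    exact norm_sq_majoritySign_sub_phaseSign_le x z
  · have hsign : majoritySign x = phaseSign z := by
      by_contra h
      exact hx (le_two_mul_card_misread h)
    rw [hsign, sub_self, norm_zero, zero_pow two_ne_zero, zero_mul]

end RotationError

section Tensor

variable {ι κ : Type*}

/-- The product state `v ⊗ w` of `ℂ^ι ⊗ ℂ^κ`. -/
def tensor : EuclideanSpace ℂ ι →ₗ[ℂ] EuclideanSpace ℂ κ →ₗ[ℂ] EuclideanSpace ℂ (ι × κ) :=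
  LinearMap.mk₂ ℂ (fun v w => WithLp.toLp 2 fun p => v p.1 * w p.2)
    (fun _ _ _ => by ext; exact add_mul _ _ _)
    (fun _ _ _ => by ext; exact mul_assoc _ _ _)
    (fun _ _ _ => by ext; exact mul_add _ _ _)
    (fun _ _ _ => by ext; exact mul_left_comm _ _ _)

theorem tensor_apply (v : EuclideanSpace ℂ ι) (w : EuclideanSpace ℂ κ) (p : ι × κ) :
    tensor v w p = v p.1 * w p.2 := rfl

variable [Fintype ι] [Fintype κ]

theorem inner_tensor (v v' : EuclideanSpace ℂ ι) (w w' : EuclideanSpace ℂ κ) :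
    inner ℂ (tensor v w) (tensor v' w') = inner ℂ v v' * inner ℂ w w' := by
  simp only [PiLp.inner_apply, Fintype.sum_prod_type, tensor_apply, RCLike.inner_apply, map_mul,
    Finset.sum_mul_sum]
  exact Finset.sum_congr rfl fun i _ => Finset.sum_congr rfl fun x _ => mul_mul_mul_comm _ _ _ _

theorem norm_tensor (v : EuclideanSpace ℂ ι) (w : EuclideanSpace ℂ κ) :
    ‖tensor v w‖ = ‖v‖ * ‖w‖ := by
  have h := inner_tensor v v w w
  simp only [inner_self_eq_norm_sq_to_K] at h
  rw [← sq_eq_sq₀ (norm_nonneg _) (by positivity), mul_pow]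
  exact_mod_cast h

theorem norm_sq_sum_tensor {α : Type*} {s : Finset α} {v : α → EuclideanSpace ℂ ι}
    (hv : Pairwise fun a b => inner ℂ (v a) (v b) = 0) (w : α → EuclideanSpace ℂ κ) :
    ‖∑ a ∈ s, tensor (v a) (w a)‖ ^ 2 = ∑ a ∈ s, ‖v a‖ ^ 2 * ‖w a‖ ^ 2 := by
  have horth : Pairwise fun a b => inner ℂ (tensor (v a) (w a)) (tensor (v b) (w b)) = 0 :=
    fun a b hab => (inner_tensor _ _ _ _).trans (by rw [hv hab, zero_mul])
  have hinner : inner ℂ (∑ a ∈ s, tensor (v a) (w a)) (∑ a ∈ s, tensor (v a) (w a))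
      = ∑ a ∈ s, inner ℂ (tensor (v a) (w a)) (tensor (v a) (w a)) := by
    rw [sum_inner]
    refine Finset.sum_congr rfl fun a ha => ?_
    rw [inner_sum, Finset.sum_eq_single_of_mem a ha fun b _ hba => horth hba.symm]
  simp only [inner_self_eq_norm_sq_to_K, norm_tensor] at hinner
  simp only [← mul_pow]
  exact_mod_cast hinner

variable [DecidableEq ι] [DecidableEq κ]

theorem kronecker_tensor (A : Matrix ι ι ℂ) (B : Matrix κ κ ℂ) (v : EuclideanSpace ℂ ι)
    (w : EuclideanSpace ℂ κ) :
    Matrix.toEuclideanLin (A ⊗ₖ B) (tensor v w)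
      = tensor (Matrix.toEuclideanLin A v) (Matrix.toEuclideanLin B w) := by
  ext ⟨i, x⟩
  simp only [Matrix.toLpLin_apply, tensor_apply, Matrix.mulVec, dotProduct, Fintype.sum_prod_type,
    Matrix.kronecker_apply, Finset.sum_mul_sum]
  exact Finset.sum_congr rfl fun j _ => Finset.sum_congr rfl fun y _ => mul_mul_mul_comm _ _ _ _

theorem blockDiagonal_tensor {M : κ → Matrix ι ι ℂ} {d : κ → ℂ} {v : EuclideanSpace ℂ ι}
    (hM : ∀ x, Matrix.toEuclideanLin (M x) v = d x • v) (w : EuclideanSpace ℂ κ) :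
    Matrix.toEuclideanLin (Matrix.blockDiagonal M) (tensor v w)
      = tensor v (Matrix.toEuclideanLin (Matrix.diagonal d) w) := by
  ext ⟨i, x⟩
  have hentry : ∑ j, M x i j * v j = d x * v i := congrArg (fun u => u i) (hM x)
  simp only [Matrix.toLpLin_apply, tensor_apply, Matrix.mulVec_diagonal]
  simp only [Matrix.mulVec, dotProduct, Fintype.sum_prod_type, Matrix.blockDiagonal_apply,
    tensor_apply, ite_mul, zero_mul, Finset.sum_ite_eq, Finset.mem_univ, if_true, ← mul_assoc,
    ← Finset.sum_mul, hentry]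
  ring

end Tensor

section Run

variable {ι : Type*} [Fintype ι] {k m : ℕ}

theorem withZeros_eq_tensor (ψ : EuclideanSpace ℂ ι) :
    withZeros k m ψ = tensor ψ (zeroState k m) := by
  ext p
  simp [withZeros, tensor_apply, zeroState]

variable [DecidableEq ι]

theorem Gate.mat_tensor {U : Matrix ι ι ℂ} {z : ℂ} {v : EuclideanSpace ℂ ι}
    (hv : Matrix.toEuclideanLin U v = z • v) (hv' : Matrix.toEuclideanLin Uᴴ v = star z • v)
    (g : Gate k m) (w : EuclideanSpace ℂ (Work k m)) :
    Matrix.toEuclideanLin (g.mat U) (tensor v w)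
      = tensor v (Matrix.toEuclideanLin (g.workspaceMat z) w) := by
  have hone : Matrix.toEuclideanLin (1 : Matrix ι ι ℂ) v = v := by
    rw [Matrix.toLpLin_one, LinearMap.id_apply]
  cases g with
  | work W => exact (kronecker_tensor 1 W v w).trans (by rw [hone]; rfl)
  | ctrl r i =>
    refine blockDiagonal_tensor (fun x => ?_) w
    split_ifs
    exacts [hv, hone.trans (one_smul ℂ v).symm]
  | ctrlInv r i =>
    refine blockDiagonal_tensor (fun x => ?_) w
    split_ifs
    exacts [hv', hone.trans (one_smul ℂ v).symm]

theorem Circuit.run_tensor {U : Matrix ι ι ℂ} {z : ℂ} {v : EuclideanSpace ℂ ι}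
    (hv : Matrix.toEuclideanLin U v = z • v) (hv' : Matrix.toEuclideanLin Uᴴ v = star z • v)
    (c : Circuit k m) (w : EuclideanSpace ℂ (Work k m)) :
    c.run U (tensor v w) = tensor v (Matrix.toEuclideanLin (c.workspaceMat z) w) := by
  induction c generalizing w with
  | nil => rw [run, mat, workspaceMat, Matrix.toLpLin_one, Matrix.toLpLin_one]; rfl
  | cons g c ih =>
    rw [run, mat, workspaceMat, toEuclideanLin_mul_apply, toEuclideanLin_mul_apply,
      Gate.mat_tensor hv hv', ← ih, run]

end Run

section Calls

variable {k m : ℕ}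

namespace Circuit

theorem calls_singleton (g : Gate k m) : calls [g] = g.calls := by
  rw [calls, List.map_singleton, List.sum_singleton]

theorem calls_append (c d : Circuit k m) : calls (c ++ d) = calls c + calls d := by
  rw [calls, List.map_append, List.sum_append, calls, calls]

theorem calls_undo (c : Circuit k m) : c.undo.calls = c.calls := by
  have hadjoint : (Gate.calls ∘ Gate.adjoint : Gate k m → ℕ) = Gate.calls := by
    funext g
    cases g <;> rfl
  rw [calls, undo, List.map_reverse, List.map_map, List.sum_reverse, hadjoint, calls]

theorem calls_flatMap {α : Type*} (f : α → Circuit k m) (l : List α) :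
    calls (l.flatMap f) = (l.map fun a => calls (f a)).sum := by
  induction l with
  | nil => rfl
  | cons a l ih => rw [List.flatMap_cons, calls_append, ih, List.map_cons, List.sum_cons]

theorem calls_replicate (n : ℕ) (g : Gate k m) : calls (List.replicate n g) = n * g.calls := by
  rw [calls, List.map_replicate, List.sum_replicate, smul_eq_mul]

end Circuit

theorem calls_estimate (r : Fin k) : Circuit.calls (estimate (m := m) r) = 2 ^ m - 1 := by
  rw [estimate, Circuit.calls_append, Circuit.calls_append, Circuit.calls_flatMap,
    Circuit.calls_singleton, Circuit.calls_singleton]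
  simp only [Circuit.calls_replicate, Gate.calls, mul_one, zero_add, add_zero]
  rw [← List.ofFn_eq_map, List.sum_ofFn, Fin.sum_univ_eq_sum_range (fun i => 2 ^ i),
    Nat.geomSum_eq le_rfl, Nat.div_one]

theorem calls_rotateCircuit (k m : ℕ) : (rotateCircuit k m).calls = 2 * (k * (2 ^ m - 1)) := by
  rw [rotateCircuit, Circuit.calls_append, Circuit.calls_append, Circuit.calls_undo,
    Circuit.calls_flatMap, Circuit.calls_singleton]
  simp only [calls_estimate, List.map_const', List.sum_replicate, List.length_finRange,
    smul_eq_mul, Gate.calls, add_zero, two_mul]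

theorem two_pow_qubits_sub_one_le {b Δ : ℝ} (h : 0 ≤ b / Δ) :
    ((2 ^ qubits b Δ - 1 : ℕ) : ℝ) ≤ 2 * (b / Δ) := by
  rcases hq : qubits b Δ with _ | n
  · rw [pow_zero, Nat.sub_self, Nat.cast_zero]
    positivity
  · have hlt : ((2 ^ n : ℕ) : ℝ) < b / Δ :=
      Nat.lt_ceil.mp ((Nat.lt_clog_iff_pow_lt one_lt_two).mp (n.lt_succ_self.trans_eq hq.symm))
    rw [Nat.cast_sub Nat.one_le_two_pow, pow_succ']
    push_cast at hlt ⊢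
    linarith

theorem div_le_two_pow_qubits (b Δ : ℝ) : b / Δ ≤ 2 ^ qubits b Δ :=
  (Nat.le_ceil _).trans (by exact_mod_cast Nat.le_pow_clog one_lt_two _)

theorem log_one_div_nonneg {ε : ℝ} (hε : 0 < ε) (hε1 : ε ≤ 1) : 0 ≤ Real.log (1 / ε) :=
  Real.log_nonneg ((one_le_div hε).mpr hε1)

theorem calls_Rotate_le {a b Δ ε : ℝ} (ha : 0 ≤ a) (hbΔ : 0 ≤ b / Δ) (hε : 0 < ε) (hε1 : ε ≤ 1) :
    ((Rotate a b Δ ε).calls : ℝ) ≤ 4 * (a * Real.log (1 / ε)) * (b / Δ) := by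
  have hlog := log_one_div_nonneg hε hε1
  have hk : (repetitions a ε : ℝ) ≤ a * Real.log (1 / ε) := Nat.floor_le (by positivity)
  have hm := two_pow_qubits_sub_one_le hbΔ
  rw [Rotate, calls_rotateCircuit, Nat.cast_mul, Nat.cast_mul, Nat.cast_two]
  calc _ ≤ 2 * ((a * Real.log (1 / ε)) * (2 * (b / Δ))) := by gcongr
    _ = _ := by ring

theorem half_pow_repetitions_le {a ε : ℝ} (ha : 2 ≤ a) (hε : 0 < ε) (hε1 : ε ≤ 1) :
    (1 / 2 : ℝ) ^ repetitions a ε ≤ 2 * ε := by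
  have hlog := log_one_div_nonneg hε hε1
  have hk : a * Real.log (1 / ε) < repetitions a ε + 1 := Nat.lt_floor_add_one _
  have hlog_two : 1 / 2 < Real.log 2 := by linarith [Real.log_two_gt_d9]
  rw [← Real.log_le_log_iff (by positivity) (by positivity), Real.log_pow,
    Real.log_mul two_ne_zero hε.ne', one_div, Real.log_inv]
  rw [one_div, Real.log_inv] at hk hlog
  nlinarith

end Calls

/-! ### Spectral decomposition of normal and unitary matrices -/

section SpectralDecomposition

open ComplexStarModule

variable {ι : Type u} [Fintype ι] [DecidableEq ι] {U : Matrix ι ι ℂ} {z z' : ℂ}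

theorem mem_eigenspace {v : EuclideanSpace ℂ ι} :
    v ∈ eigenspace U z ↔ Matrix.toEuclideanLin U v = z • v :=
  Module.End.mem_eigenspace_iff

theorem toEuclideanLin_conjTranspose_of_mem_eigenspace [IsStarNormal U]
    {v : EuclideanSpace ℂ ι} (hv : v ∈ eigenspace U z) :
    Matrix.toEuclideanLin Uᴴ v = star z • v := by
  have hnormal : IsStarNormal (Matrix.toEuclideanCLM (𝕜 := ℂ) (U - z • 1)) := by
    have hcomm : Commute U (star (z • (1 : Matrix ι ι ℂ))) := by
      rw [star_smul, star_one]
      exact (Commute.one_right U).smul_right _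
    have := hcomm.isStarNormal_sub
    infer_instance
  have hsub : (Matrix.toEuclideanCLM (𝕜 := ℂ) (U - z • 1)) v = 0 := by
    rw [map_sub, map_smul, map_one]
    exact sub_eq_zero.mpr (mem_eigenspace.mp hv)
  have hadj := (ContinuousLinearMap.IsStarNormal.adjoint_apply_eq_zero_iff hnormal v).mpr hsub
  rw [← ContinuousLinearMap.star_eq_adjoint, ← map_star, star_sub, star_smul, star_one, map_sub,
    map_smul, map_one] at hadj
  exact sub_eq_zero.mp hadj

theorem inner_eq_zero_of_mem_eigenspace [IsStarNormal U] (hne : z ≠ z')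
    {w w' : EuclideanSpace ℂ ι} (hw : w ∈ eigenspace U z) (hw' : w' ∈ eigenspace U z') :
    inner ℂ w w' = 0 := by
  have h : inner ℂ (Matrix.toEuclideanLin Uᴴ w) w' = inner ℂ w (Matrix.toEuclideanLin U w') := by
    rw [Matrix.toEuclideanLin_conjTranspose_eq_adjoint, LinearMap.adjoint_inner_left]
  rw [toEuclideanLin_conjTranspose_of_mem_eigenspace hw, mem_eigenspace.mp hw', inner_smul_left,
    inner_smul_right, starRingEnd_apply, star_star] at h
  exact (mul_eq_mul_right_iff.mp h).resolve_left hne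

theorem iSup_eigenspace_eq_top [IsStarNormal U] : ⨆ z, eigenspace U z = ⊤ := by
  have hre := Matrix.isSymmetric_toEuclideanLin_iff.mpr (ℜ U).2
  have him := Matrix.isSymmetric_toEuclideanLin_iff.mpr (ℑ U).2
  have hcomm : Commute (Matrix.toEuclideanLin (ℜ U : Matrix ι ι ℂ))
      (Matrix.toEuclideanLin (ℑ U : Matrix ι ι ℂ)) := by
    rw [Commute, SemiconjBy, Module.End.mul_eq_comp, Module.End.mul_eq_comp,
      ← Matrix.toLpLin_mul_same, ← Matrix.toLpLin_mul_same, (Commute.realPart_imaginaryPart U).eq]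
  rw [eq_top_iff, ← hre.iSup_iSup_eigenspace_inf_eigenspace_eq_top_of_commute him hcomm]
  refine iSup₂_le fun a b v ⟨ha, hb⟩ => Submodule.mem_iSup_of_mem (a + Complex.I * b) ?_
  rw [SetLike.mem_coe, Module.End.mem_eigenspace_iff] at ha hb
  rw [mem_eigenspace, ← realPart_add_I_smul_imaginaryPart U]
  simp [ha, hb, add_smul, mul_smul]

theorem eigencomponent_mem (U : Matrix ι ι ℂ) (z : ℂ) (ψ : EuclideanSpace ℂ ι) :
    eigencomponent U z ψ ∈ eigenspace U z :=
  Submodule.starProjection_apply_mem _ _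

/-- The eigenvalues of `U`, without multiplicity. -/
def eigenvalueFinset (U : Matrix ι ι ℂ) : Finset ℂ :=
  (Module.End.finite_hasEigenvalue (Matrix.toEuclideanLin U)).toFinset

theorem mem_eigenvalueFinset :
    z ∈ eigenvalueFinset U ↔ Module.End.HasEigenvalue (Matrix.toEuclideanLin U) z :=
  (Module.End.finite_hasEigenvalue _).mem_toFinset

theorem eigenspace_eq_bot (hz : z ∉ eigenvalueFinset U) : eigenspace U z = ⊥ :=
  not_not.mp (mem_eigenvalueFinset.not.mp hz)

theorem eigencomponent_eq_zero (hz : z ∉ eigenvalueFinset U) (ψ : EuclideanSpace ℂ ι) :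
    eigencomponent U z ψ = 0 :=
  (Submodule.mem_bot ℂ).mp (eigenspace_eq_bot hz ▸ eigencomponent_mem U z ψ)

theorem inner_eigencomponent_eq_zero [IsStarNormal U] (ψ : EuclideanSpace ℂ ι) :
    Pairwise fun z z' => inner ℂ (eigencomponent U z ψ) (eigencomponent U z' ψ) = 0 :=
  fun z z' hne => inner_eq_zero_of_mem_eigenspace hne (eigencomponent_mem U z ψ)
    (eigencomponent_mem U z' ψ)

theorem orthogonalFamily_eigenspace [IsStarNormal U] :
    OrthogonalFamily ℂ (fun z => eigenspace U z) fun z => (eigenspace U z).subtypeₗᵢ :=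
  fun _ _ hne w w' => inner_eq_zero_of_mem_eigenspace hne w.2 w'.2

theorem iSup_eigenvalueFinset_eigenspace_eq_top [IsStarNormal U] :
    ⨆ z : eigenvalueFinset U, eigenspace U z = ⊤ := by
  rw [eq_top_iff, ← iSup_eigenspace_eq_top (U := U)]
  refine iSup_le fun z => ?_
  by_cases hz : z ∈ eigenvalueFinset U
  · exact le_iSup (fun z : eigenvalueFinset U => eigenspace U z) ⟨z, hz⟩
  · exact (eigenspace_eq_bot hz).trans_le bot_le

theorem sum_eigencomponent [IsStarNormal U] (ψ : EuclideanSpace ℂ ι) :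
    ∑ z ∈ eigenvalueFinset U, eigencomponent U z ψ = ψ := by
  have horth := (orthogonalFamily_eigenspace (U := U)).comp
    (Subtype.val_injective (p := (· ∈ eigenvalueFinset U)))
  rw [← Finset.sum_coe_sort]
  exact horth.sum_projection_of_mem_iSup ψ
    (iSup_eigenvalueFinset_eigenspace_eq_top.ge Submodule.mem_top)

theorem sum_norm_sq_eigencomponent [IsStarNormal U] (ψ : EuclideanSpace ℂ ι) :
    ∑ z ∈ eigenvalueFinset U, ‖eigencomponent U z ψ‖ ^ 2 = ‖ψ‖ ^ 2 := by
  have h := (orthogonalFamily_eigenspace (U := U)).norm_sum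
    (fun z => ⟨eigencomponent U z ψ, eigencomponent_mem U z ψ⟩) (eigenvalueFinset U)
  conv_rhs => rw [← sum_eigencomponent (U := U) ψ]
  exact h.symm

theorem norm_eq_one_of_mem_eigenvalueFinset (hU : U ∈ Matrix.unitaryGroup ι ℂ)
    (hz : z ∈ eigenvalueFinset U) : ‖z‖ = 1 := by
  obtain ⟨v, hv⟩ := (mem_eigenvalueFinset.mp hz).exists_hasEigenvector
  have h := norm_toEuclideanLin hU v
  rw [hv.apply_eq_smul, norm_smul] at h
  exact mul_right_cancel₀ (norm_ne_zero_iff.mpr hv.2) (h.trans (one_mul _).symm)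

end SpectralDecomposition

/-! ### Eigenvalues of real orthogonal matrices -/

section Conjugation

variable {ι : Type*}

/-- The entrywise complex conjugate of a vector; `conjVec ψ = ψ` says that `ψ` is real. -/
def conjVec (v : EuclideanSpace ℂ ι) : EuclideanSpace ℂ ι := WithLp.toLp 2 (star v.ofLp)

theorem conjVec_sub (v w : EuclideanSpace ℂ ι) : conjVec (v - w) = conjVec v - conjVec w :=
  congrArg (WithLp.toLp 2) (star_sub v.ofLp w.ofLp)

variable [Fintype ι]

theorem norm_conjVec (v : EuclideanSpace ℂ ι) : ‖conjVec v‖ = ‖v‖ := by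
  simp [conjVec, EuclideanSpace.norm_eq]

theorem inner_conjVec_left (v w : EuclideanSpace ℂ ι) :
    inner ℂ (conjVec v) w = starRingEnd ℂ (inner ℂ v (conjVec w)) := by
  simp [conjVec, PiLp.inner_apply, map_sum]

variable [DecidableEq ι] {U : Matrix ι ι ℂ} {z : ℂ} {ψ : EuclideanSpace ℂ ι}

theorem toEuclideanLin_conjVec (hreal : U.map star = U) (v : EuclideanSpace ℂ ι) :
    Matrix.toEuclideanLin U (conjVec v) = conjVec (Matrix.toEuclideanLin U v) := by
  have hU (i j) : starRingEnd ℂ (U i j) = U i j := congrFun₂ hreal i j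
  ext i
  simp [conjVec, Matrix.mulVec, dotProduct, hU]

theorem conjVec_mem_eigenspace (hreal : U.map star = U) {v : EuclideanSpace ℂ ι}
    (hv : v ∈ eigenspace U z) : conjVec v ∈ eigenspace U (starRingEnd ℂ z) := by
  rw [mem_eigenspace, toEuclideanLin_conjVec hreal, mem_eigenspace.mp hv]
  exact congrArg (WithLp.toLp 2) (star_smul z v.ofLp)

theorem eigencomponent_conj (hreal : U.map star = U) (hψ : conjVec ψ = ψ) (z : ℂ) :
    eigencomponent U (starRingEnd ℂ z) ψ = conjVec (eigencomponent U z ψ) := by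
  refine Submodule.eq_starProjection_of_mem_of_inner_eq_zero
    (conjVec_mem_eigenspace hreal (eigencomponent_mem U z ψ)) fun v hv => ?_
  have hv' : conjVec v ∈ eigenspace U z := by
    simpa using conjVec_mem_eigenspace hreal hv
  have horth : inner ℂ (ψ - eigencomponent U z ψ) (conjVec v) = 0 :=
    Submodule.starProjection_inner_eq_zero ψ (conjVec v) hv'
  rw [← hψ, ← conjVec_sub, hψ, inner_conjVec_left, horth, map_zero]

theorem conj_mem_eigenvalueFinset (hreal : U.map star = U) (hz : z ∈ eigenvalueFinset U) :
    starRingEnd ℂ z ∈ eigenvalueFinset U := by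
  obtain ⟨v, hv⟩ := (mem_eigenvalueFinset.mp hz).exists_hasEigenvector
  have hne : conjVec v ≠ 0 :=
    norm_ne_zero_iff.mp ((norm_conjVec v).trans_ne (norm_ne_zero_iff.mpr hv.2))
  exact mem_eigenvalueFinset.mpr
    (Module.End.hasEigenvalue_of_hasEigenvector ⟨conjVec_mem_eigenspace hreal hv.1, hne⟩)

theorem mem_upperEigenvalues : z ∈ upperEigenvalues U ↔ z ∈ eigenvalueFinset U ∧ 0 < z.im :=
  Finset.mem_filter

theorem eq_one_or_eq_neg_one_of_norm_eq_one {z : ℂ} (hz : ‖z‖ = 1) (him : z.im = 0) :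
    z = 1 ∨ z = -1 := by
  have hre : z = (z.re : ℂ) := Complex.ext rfl him
  rw [hre, Complex.norm_real, Real.norm_eq_abs] at hz
  rcases eq_or_eq_neg_of_abs_eq hz with h | h
  · exact .inl (by rw [hre, h, Complex.ofReal_one])
  · exact .inr (by rw [hre, h, Complex.ofReal_neg, Complex.ofReal_one])

variable {M : Type*} [AddCommMonoid M]

theorem sum_conj_upperEigenvalues (hreal : U.map star = U) (F : ℂ → M) :
    ∑ z ∈ upperEigenvalues U, F (starRingEnd ℂ z)
      = ∑ z ∈ eigenvalueFinset U with z.im < 0, F z := by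
  refine Finset.sum_nbij' (starRingEnd ℂ) (starRingEnd ℂ) (fun z hz => ?_) (fun z hz => ?_)
    (fun z _ => Complex.conj_conj z) (fun z _ => Complex.conj_conj z) (fun _ _ => rfl)
  · obtain ⟨hev, him⟩ := mem_upperEigenvalues.mp hz
    exact Finset.mem_filter.mpr ⟨conj_mem_eigenvalueFinset hreal hev,
      by rwa [Complex.conj_im, neg_lt_zero]⟩
  · obtain ⟨hev, him⟩ := Finset.mem_filter.mp hz
    exact mem_upperEigenvalues.mpr ⟨conj_mem_eigenvalueFinset hreal hev,
      by rwa [Complex.conj_im, neg_pos]⟩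

theorem sum_eigenvalueFinset_im_eq_zero (hU : U ∈ Matrix.unitaryGroup ι ℂ) (F : ℂ → M)
    (hF : ∀ z ∉ eigenvalueFinset U, F z = 0) :
    ∑ z ∈ eigenvalueFinset U with z.im = 0, F z = F 1 + F (-1) := by
  rw [← Finset.sum_pair (f := F) (by norm_num : (1 : ℂ) ≠ -1)]
  refine Finset.sum_subset (fun z hz => ?_) fun z hz hz' => hF z fun hev => hz' ?_
  · obtain ⟨hev, him⟩ := Finset.mem_filter.mp hz
    have h := eq_one_or_eq_neg_one_of_norm_eq_one
      (norm_eq_one_of_mem_eigenvalueFinset hU hev) him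
    rwa [Finset.mem_insert, Finset.mem_singleton]
  · refine Finset.mem_filter.mpr ⟨hev, ?_⟩
    rcases Finset.mem_insert.mp hz with rfl | h
    · exact Complex.one_im
    · rw [Finset.mem_singleton.mp h, Complex.neg_im, Complex.one_im, neg_zero]

theorem sum_eigenvalueFinset (hU : U ∈ Matrix.unitaryGroup ι ℂ) (hreal : U.map star = U)
    (F : ℂ → M) (hF : ∀ z ∉ eigenvalueFinset U, F z = 0) :
    ∑ z ∈ eigenvalueFinset U, F z
      = F 1 + ∑ z ∈ upperEigenvalues U, (F z + F (starRingEnd ℂ z)) + F (-1) := by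
  have hlower : (eigenvalueFinset U).filter (fun z => ¬0 < z.im) =
      (eigenvalueFinset U).filter (fun z => z.im < 0)
        ∪ (eigenvalueFinset U).filter (fun z => z.im = 0) := by
    rw [← Finset.filter_or]
    exact Finset.filter_congr fun z _ => not_lt.trans le_iff_lt_or_eq
  have hdisj : Disjoint ((eigenvalueFinset U).filter (fun z => z.im < 0))
      ((eigenvalueFinset U).filter (fun z => z.im = 0)) :=
    Finset.disjoint_filter.mpr fun z _ h => h.ne
  rw [← Finset.sum_filter_add_sum_filter_not _ (fun z : ℂ => 0 < z.im), hlower,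
    Finset.sum_union hdisj, sum_eigenvalueFinset_im_eq_zero hU F hF,
    ← sum_conj_upperEigenvalues hreal, Finset.sum_add_distrib]
  change ∑ z ∈ upperEigenvalues U, F z + _ = _
  abel

end Conjugation

section RotationAndHittingTime

variable {ι : Type*} [Fintype ι] [DecidableEq ι] {U : Matrix ι ι ℂ}

theorem rotation_eq_sum (hU : U ∈ Matrix.unitaryGroup ι ℂ) (hreal : U.map star = U)
    (ψ : EuclideanSpace ℂ ι) :
    rotation U ψ = ∑ z ∈ eigenvalueFinset U, phaseSign z • eigencomponent U z ψ := by
  have hupper : ∀ z ∈ upperEigenvalues U, phaseSign z • eigencomponent U z ψ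
      + phaseSign (starRingEnd ℂ z) • eigencomponent U (starRingEnd ℂ z) ψ
      = eigencomponent U z ψ - eigencomponent U (starRingEnd ℂ z) ψ := fun z hz => by
    have him := (mem_upperEigenvalues.mp hz).2
    have hconj : ¬0 ≤ (starRingEnd ℂ z).arg := by
      rwa [Complex.arg_nonneg_iff, Complex.conj_im, neg_nonneg, not_le]
    rw [phaseSign, phaseSign, if_pos (Complex.arg_nonneg_iff.mpr him.le), if_neg hconj, one_smul,
      neg_one_smul, sub_eq_add_neg]
  rw [sum_eigenvalueFinset hU hreal _ fun z hz => by
    rw [eigencomponent_eq_zero hz, smul_zero],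
    Finset.sum_congr rfl hupper, rotation]
  simp [phaseSign, Real.pi_pos.le]

/-- For `z = 1` the division gives `1 / 0 = 0`, the value of `QH` on the eigenvalue `1`. -/
theorem lawQH_eq_sum (hU : U ∈ Matrix.unitaryGroup ι ℂ) (hreal : U.map star = U)
    {ψ : EuclideanSpace ℂ ι} (hψ : conjVec ψ = ψ) :
    lawQH U ψ = ∑ z ∈ eigenvalueFinset U,
      ENNReal.ofReal (‖eigencomponent U z ψ‖ ^ 2) • Measure.dirac (1 / |z.arg|) := by
  have hupper : ∀ z ∈ upperEigenvalues U,
      ENNReal.ofReal (‖eigencomponent U z ψ‖ ^ 2) • Measure.dirac (1 / |z.arg|)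
        + ENNReal.ofReal (‖eigencomponent U (starRingEnd ℂ z) ψ‖ ^ 2)
          • Measure.dirac (1 / |(starRingEnd ℂ z).arg|)
      = ENNReal.ofReal (2 * ‖eigencomponent U z ψ‖ ^ 2) • Measure.dirac (1 / z.arg) :=
    fun z hz => by
      have him := (mem_upperEigenvalues.mp hz).2
      have harg : 0 ≤ z.arg := Complex.arg_nonneg_iff.mpr him.le
      have hne : z.arg ≠ Real.pi := fun h => him.ne' (Complex.arg_eq_pi_iff.mp h).2
      rw [eigencomponent_conj hreal hψ, norm_conjVec, Complex.arg_conj, if_neg hne, abs_neg,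
        abs_of_nonneg harg, ← add_smul, ← ENNReal.ofReal_add (by positivity) (by positivity),
        two_mul]
  rw [sum_eigenvalueFinset hU hreal _ fun z hz => by
    rw [eigencomponent_eq_zero hz, norm_zero, sq, mul_zero,
      ENNReal.ofReal_zero, zero_smul], Finset.sum_congr rfl hupper, lawQH, Complex.arg_one,
    Complex.arg_neg_one, abs_zero, div_zero, abs_of_pos Real.pi_pos]
  abel

theorem lawQH_Ioi (hU : U ∈ Matrix.unitaryGroup ι ℂ) (hreal : U.map star = U)
    {ψ : EuclideanSpace ℂ ι} (hψ : conjVec ψ = ψ) (T : ℝ) :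
    lawQH U ψ (Set.Ioi T) = ENNReal.ofReal
      (∑ z ∈ eigenvalueFinset U with T < 1 / |z.arg|, ‖eigencomponent U z ψ‖ ^ 2) := by
  rw [lawQH_eq_sum hU hreal hψ, ENNReal.ofReal_sum_of_nonneg fun z _ => by positivity,
    Finset.sum_filter, Measure.finsetSum_apply]
  refine Finset.sum_congr rfl fun z _ => ?_
  rw [Measure.smul_apply, Measure.dirac_apply' _ measurableSet_Ioi, smul_eq_mul,
    Set.indicator_apply, Pi.one_apply, mul_ite, mul_one, mul_zero]
  rfl

end RotationAndHittingTime

section RotationBound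

variable {ι : Type*} [Fintype ι] [DecidableEq ι] {U : Matrix ι ι ℂ} {k m : ℕ}

theorem norm_sq_run_sub_rotation (hU : U ∈ Matrix.unitaryGroup ι ℂ) (hreal : U.map star = U)
    (ψ : EuclideanSpace ℂ ι) :
    ‖(rotateCircuit k m).run U (withZeros k m ψ) - withZeros k m (rotation U ψ)‖ ^ 2
      = ∑ z ∈ eigenvalueFinset U, ‖eigencomponent U z ψ‖ ^ 2 * ‖rotationError k m z‖ ^ 2 := by
  have : IsStarNormal U := isStarNormal_of_mem_unitary hU
  have hrun : (rotateCircuit k m).run U (withZeros k m ψ) = ∑ z ∈ eigenvalueFinset U,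
      tensor (eigencomponent U z ψ)
        (Matrix.toEuclideanLin (Circuit.workspaceMat z (rotateCircuit k m)) (zeroState k m)) := by
    rw [withZeros_eq_tensor]
    nth_rw 1 [← sum_eigencomponent (U := U) ψ]
    rw [map_sum, LinearMap.sum_apply, Circuit.run, map_sum]
    refine Finset.sum_congr rfl fun z _ => ?_
    have hmem := eigencomponent_mem U z ψ
    exact Circuit.run_tensor (mem_eigenspace.mp hmem)
      (toEuclideanLin_conjTranspose_of_mem_eigenspace hmem) _ _
  rw [hrun, rotation_eq_sum hU hreal, withZeros_eq_tensor, map_sum, LinearMap.sum_apply,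
    ← Finset.sum_sub_distrib, ← norm_sq_sum_tensor (inner_eigencomponent_eq_zero ψ)]
  simp only [rotationError, map_sub, map_smul, LinearMap.smul_apply]

theorem eq_one_or_one_le_mul_abs_arg {z : ℂ} (hz : ‖z‖ = 1) {T : ℝ} (hT : 1 / |z.arg| ≤ T) :
    z = 1 ∨ 1 ≤ T * |z.arg| := by
  by_cases harg : z.arg = 0
  · exact .inl (Complex.ext_norm_arg (by rw [hz, norm_one]) (by rw [harg, Complex.arg_one]))
  · exact .inr ((div_le_iff₀ (abs_pos.mpr harg)).mp hT)

theorem norm_sq_run_sub_rotation_le (hU : U ∈ Matrix.unitaryGroup ι ℂ)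
    (hreal : U.map star = U) (hphase : PhasesAtMostHalfPi U) {ψ : EuclideanSpace ℂ ι}
    (hψ : conjVec ψ = ψ) {T ε : ℝ} (hε : 0 ≤ ε)
    (htail : lawQH U ψ (Set.Ioi T) ≤ ENNReal.ofReal ε) (hprec : 74 * Real.pi * T ≤ 2 ^ m) :
    ‖(rotateCircuit k m).run U (withZeros k m ψ) - withZeros k m (rotation U ψ)‖ ^ 2
      ≤ 4 * (1 / 2) ^ k * ‖ψ‖ ^ 2 + 4 * ε := by
  have : IsStarNormal U := isStarNormal_of_mem_unitary hU
  rw [lawQH_Ioi hU hreal hψ, ENNReal.ofReal_le_ofReal_iff hε] at htail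
  have herror : ∀ z ∈ eigenvalueFinset U,
      ‖rotationError k m z‖ ^ 2 ≤ 4 * (1 / 2) ^ k + if T < 1 / |z.arg| then 4 else 0 := by
    intro z hz
    have hnorm := norm_eq_one_of_mem_eigenvalueFinset hU hz
    split_ifs with hsmall
    · exact (norm_sq_rotationError_le_four k m hnorm).trans (le_add_of_nonneg_left (by positivity))
    · rw [add_zero]
      refine norm_sq_rotationError_le k hnorm (hphase z (mem_eigenvalueFinset.mp hz)) ?_
      refine (eq_one_or_one_le_mul_abs_arg hnorm (not_lt.mp hsmall)).imp_right fun h => ?_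
      calc 74 * Real.pi ≤ 74 * Real.pi * (T * |z.arg|) :=
            le_mul_of_one_le_right (by positivity) h
        _ = 74 * Real.pi * T * |z.arg| := (mul_assoc _ _ _).symm
        _ ≤ 2 ^ m * |z.arg| := by gcongr
  calc ‖(rotateCircuit k m).run U (withZeros k m ψ) - withZeros k m (rotation U ψ)‖ ^ 2
      = ∑ z ∈ eigenvalueFinset U, ‖eigencomponent U z ψ‖ ^ 2 * ‖rotationError k m z‖ ^ 2 :=
        norm_sq_run_sub_rotation hU hreal ψ
    _ ≤ ∑ z ∈ eigenvalueFinset U, ‖eigencomponent U z ψ‖ ^ 2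
          * (4 * (1 / 2) ^ k + if T < 1 / |z.arg| then 4 else 0) :=
        Finset.sum_le_sum fun z hz => by gcongr; exact herror z hz
    _ = 4 * (1 / 2) ^ k * ∑ z ∈ eigenvalueFinset U, ‖eigencomponent U z ψ‖ ^ 2
          + 4 * ∑ z ∈ eigenvalueFinset U with T < 1 / |z.arg|, ‖eigencomponent U z ψ‖ ^ 2 := by
        simp only [mul_add, Finset.sum_add_distrib, mul_ite, mul_zero, ← Finset.sum_filter,
          ← Finset.sum_mul]
        ring
    _ ≤ 4 * (1 / 2) ^ k * ‖ψ‖ ^ 2 + 4 * ε := by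
        rw [sum_norm_sq_eigencomponent]
        gcongr

end RotationBound

/-! ### Abstract search -/

namespace AbstractSearch

variable {ι : Type*} [Fintype ι] [DecidableEq ι] (S : AbstractSearch ι)

theorem U₁_mem : S.U₁ ∈ Matrix.orthogonalGroup ι ℝ := by
  have hμ : (fun i => S.μ i) ⬝ᵥ (fun i => S.μ i) = 1 := by
    have h := EuclideanSpace.real_norm_sq_eq S.μ
    rw [S.norm_μ, one_pow] at h
    simp only [dotProduct, ← sq, h]
  have hsymm : S.U₁ᵀ = S.U₁ := by
    rw [U₁, Matrix.transpose_sub, Matrix.transpose_one, Matrix.transpose_smul,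
      Matrix.transpose_vecMulVec]
  rw [Matrix.mem_orthogonalGroup_iff, hsymm, U₁, sub_mul, mul_sub, mul_sub, one_mul, mul_one,
    one_mul, Matrix.smul_mul, Matrix.mul_smul, Matrix.vecMulVec_mul_vecMulVec, hμ, one_smul]
  module

theorem U_mem : S.U ∈ Matrix.unitaryGroup ι ℂ := by
  have h := (Matrix.mem_orthogonalGroup_iff ι ℝ).mp (mul_mem S.U₂_mem S.U₁_mem)
  have hU : S.U = (S.U₂ * S.U₁).map Complex.ofRealHom := rfl
  have hstar : star S.U = ((S.U₂ * S.U₁)ᵀ).map Complex.ofRealHom := by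
    ext i j
    exact Complex.conj_ofReal _
  rw [Matrix.mem_unitaryGroup_iff, hstar, hU, ← Matrix.map_mul, h,
    Matrix.map_one _ (map_zero _) (map_one _)]

theorem U_map_star : S.U.map star = S.U := by
  ext i j
  exact Complex.conj_ofReal _

theorem conjVec_start : conjVec S.start = S.start := by
  ext i
  exact Complex.conj_ofReal _

theorem norm_start_le : ‖S.start‖ ≤ 1 := by
  have hreal : ‖S.start‖ = ‖S.φ₀ - inner ℝ S.φ₀ S.μ • S.μ‖ := by
    simp only [EuclideanSpace.norm_eq, start, Complex.norm_real]
  have hsq : ‖S.φ₀ - inner ℝ S.φ₀ S.μ • S.μ‖ ^ 2 = 1 - inner ℝ S.φ₀ S.μ ^ 2 := by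
    rw [norm_sub_sq_real, inner_smul_right, norm_smul, mul_pow, S.norm_φ₀, S.norm_μ,
      Real.norm_eq_abs, sq_abs]
    ring
  rw [hreal, ← sq_le_one_iff₀ (norm_nonneg _), hsq]
  exact sub_le_self _ (sq_nonneg _)

theorem lawQH_Ioi_le {T ε : ℝ} (hε : 0 < ε) (hT : S.hittingTime ε ≤ T) :
    lawQH S.U S.start (Set.Ioi T) ≤ ENNReal.ofReal ε :=
  (measure_mono (Set.Ioi_subset_Ioi hT)).trans (S.hittingTime_isLeast hε).1.2

end AbstractSearch

section Rotate

variable {ι : Type*} [Fintype ι] [DecidableEq ι] {U : Matrix ι ι ℂ}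

theorem norm_run_Rotate_sub_rotation_le (hU : U ∈ Matrix.unitaryGroup ι ℂ)
    (hreal : U.map star = U) (hphase : PhasesAtMostHalfPi U) {ψ : EuclideanSpace ℂ ι}
    (hψ : conjVec ψ = ψ) (hnorm : ‖ψ‖ ≤ 1) {a b T ε : ℝ} (ha : 2 ≤ a) (hb : 74 * Real.pi ≤ b)
    (hT : 0 ≤ T) (hε : 0 < ε) (hε1 : ε ≤ 1) (htail : lawQH U ψ (Set.Ioi T) ≤ ENNReal.ofReal ε) :
    ‖(Rotate a b (1 / T) ε).run U (withZeros _ _ ψ) - withZeros _ _ (rotation U ψ)‖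
      ≤ 4 * √ε := by
  have hprec : 74 * Real.pi * T ≤ 2 ^ qubits b (1 / T) :=
    calc 74 * Real.pi * T ≤ b * T := by gcongr
      _ = b / (1 / T) := by rw [div_div_eq_mul_div, div_one]
      _ ≤ 2 ^ qubits b (1 / T) := div_le_two_pow_qubits b (1 / T)
  refine abs_le_of_sq_le_sq' ?_ (by positivity) |>.2
  calc _ ≤ 4 * (1 / 2) ^ repetitions a ε * ‖ψ‖ ^ 2 + 4 * ε :=
        norm_sq_run_sub_rotation_le hU hreal hphase hψ hε.le htail hprec
    _ ≤ 4 * (2 * ε) * 1 ^ 2 + 4 * ε := by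
        gcongr
        exact half_pow_repetitions_le ha hε hε1
    _ ≤ 16 * ε := by linarith
    _ = (4 * √ε) ^ 2 := by rw [mul_pow, Real.sq_sqrt hε.le]; norm_num

end Rotate

end

end QuantumSearch

open QuantumSearch in
theorem mainTheorem8_general :
    ∃ a₀ b₀ : ℝ, 0 < a₀ ∧ 0 < b₀ ∧ ∀ a b : ℝ, a₀ ≤ a → b₀ ≤ b →
      ∃ C : ℝ, 0 < C ∧
        ∀ {ι : Type*} [Fintype ι] [DecidableEq ι] (U : Matrix ι ι ℂ) (ψ : EuclideanSpace ℂ ι),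
          U ∈ Matrix.unitaryGroup ι ℂ → U.map star = U → PhasesAtMostHalfPi U →
          conjVec ψ = ψ → ‖ψ‖ ≤ 1 →
          ∀ ε : ℝ, 0 < ε → ε < 1 →
          ∀ T : ℝ, 0 < T → lawQH U ψ (Set.Ioi T) ≤ ENNReal.ofReal ε →
            ‖(Rotate a b (1 / T) ε).run U (withZeros _ _ ψ) - withZeros _ _ (rotation U ψ)‖
                ≤ C * √ε
              ∧ ((Rotate a b (1 / T) ε).calls : ℝ) ≤ C * Real.log (1 / ε) * T := by
  refine ⟨2, 74 * Real.pi, by positivity, by positivity, fun a b ha hb => ?_⟩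
  have ha0 : 0 ≤ a := zero_le_two.trans ha
  have hb0 : 0 ≤ b := le_trans (by positivity) hb
  refine ⟨4 + 4 * a * b, by positivity, fun U ψ hU hreal hphase hψ hnorm ε hε hε1 T hT htail => ?_⟩
  have hlog : 0 ≤ Real.log (1 / ε) := log_one_div_nonneg hε hε1.le
  constructor
  · calc _ ≤ 4 * √ε :=
          norm_run_Rotate_sub_rotation_le hU hreal hphase hψ hnorm ha hb hT.le hε hε1.le htail
      _ ≤ (4 + 4 * a * b) * √ε := by gcongr; exact le_add_of_nonneg_right (by positivity)
  · calc _ ≤ 4 * (a * Real.log (1 / ε)) * (b / (1 / T)) :=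
          calls_Rotate_le ha0 (by positivity) hε hε1.le
      _ = 4 * a * b * Real.log (1 / ε) * T := by rw [div_div_eq_mul_div, div_one]; ring
      _ ≤ (4 + 4 * a * b) * Real.log (1 / ε) * T := by
          gcongr
          exact le_add_of_nonneg_left zero_le_four

theorem mainTheorem8 :
    ∃ a₀ b₀ : ℝ, 0 < a₀ ∧ 0 < b₀ ∧ ∀ a b : ℝ, a₀ ≤ a → b₀ ≤ b →
      ∃ C : ℝ, 0 < C ∧
        ∀ {ι : Type*} [Fintype ι] [DecidableEq ι] (S : QuantumSearch.AbstractSearch ι),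
          QuantumSearch.PhasesAtMostHalfPi S.U →
          ∀ ε : ℝ, 0 < ε → ε < 1 →
          ∀ T : ℝ, 0 < T → S.hittingTime ε ≤ T →
            ‖(QuantumSearch.Rotate a b (1 / T) ε).run S.U (QuantumSearch.withZeros _ _ S.start)
                - QuantumSearch.withZeros _ _ (QuantumSearch.rotation S.U S.start)‖
                ≤ C * Real.sqrt ε
              ∧ ((QuantumSearch.Rotate a b (1 / T) ε).calls : ℝ) ≤ C * Real.log (1 / ε) * T :=
  by
  obtain ⟨a₀, b₀, ha₀, hb₀, h⟩ := mainTheorem8_general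
  refine ⟨a₀, b₀, ha₀, hb₀, fun a b ha hb => (h a b ha hb).imp fun C hC => ⟨hC.1, ?_⟩⟩
  exact fun S hphase ε hε hε1 T hT hhit => hC.2 S.U S.start S.U_mem S.U_map_star hphase
    S.conjVec_start S.norm_start_le ε hε hε1 T hT (S.lawQH_Ioi_le hε hhit)
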